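/- **Setting.** Consider an episodic MDP with state set $\mathcal S$, finite non-empty action set $\mathcal A$, horizon $H$, initial state distribution $\mu$, true transition model $M^\star$ and reward function $R^\star:\mathcal S\to[0,1]$; all distributions over states are discrete. A model $M$ maps each $(s,a)$ to a distribution $P_M(\cdot\mid s,a)$ over next states. For a (possibly randomized and time-dependent) Markov policy $\pi$, let $P_M^{\pi,h}$ be the law of the state at time $h$ when $s_0\sim\mu$, actions are drawn from $\pi$ and transitions from $M$. Put $v_M(\pi)=\sum_{h=1}^H\sum_s P_M^{\pi,h}(s)R^\star(s)$. Let $\mathcal M$ be a finite set of models and $\Pi$ a finite set of policies. For $1\le h\le H$ let $$\mathcal D(\pi,M,M',h)=\frac1{|\mathcal A|}\sum_{s,a,s'}\big|P_M(s'|s,a)P_M^{\pi,h-1}(s)-P_{M'}(s'|s,a)P_{M'}^{\pi,h-1}(s)\big|,$$ $$\mathcal W(\pi,M,h)=\mathbb E_{s\sim P^{\pi,h-1}_{M^\star},\,a\sim U(\mathcal A)}\big\|P_M(\cdot|s,a)-P_{M^\star}(\cdot|s,a)\big\|_{1}.$$ For a real matrix $B$, let $\mathrm{rank}(B,\beta)$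 be the least $k$ such that $B=UV^\top$ with $k$ columns in $U$ and $V$ and $\|u_i\|_2\|v_j\|_2\le\beta$ for all rows $u_i$ of $U$ and $v_j$ of $V$. Let $d=\max_{1\le h\le H}\mathrm{rank}(A_h,\beta)$, assumed finite, where $A_h=(\mathcal W(\pi,M,h))_{\pi\in\Pi,M\in\mathcal M}$ are the model misfit matrices. **Algorithm (DREEM with parameters $n,\epsilon,\phi$).** Start with $\mathcal M_1=\mathcal M$. In round $t$ let $\pi_t$ maximize $v_{\mathrm{explore}}(\pi,\mathcal M_t)=\max_{M,M'\in\mathcal M_t}\sum_{h=1}^H\mathcal D(\pi,M,M',h)$ over $\pi\in\Pi$. If $v_{\mathrm{explore}}(\pi_t,\mathcal M_t)>\epsilon/|\mathcal A|$, collect $n$ fresh independent trajectories with $\pi_t$; the $i$-th one supplies, for every $h\le H$, a triple $(s^{(i)}_{h-1},a^{(i)}_{h-1},s^{(i)}_h)$ with $s^{(i)}_{h-1}\sim P^{\pi_t,h-1}_{M^\star}$, $a^{(i)}_{h-1}\sim U(\mathcal A)$, $s^{(i)}_h\sim P_{M^\star}(\cdot|s^{(i)}_{h-1},a^{(i)}_{h-1})$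 (with an arbitrary joint law over different $h$). Set $\mathcal M_{t+1}=\{M\in\mathcal M_t:\widetilde{\mathcal W}(M,h)\le\phi\ \forall h\le H\}$, where $$\widetilde{\mathcal W}(M,h)=\max_{f\in\widetilde{\mathcal F}}\frac1n\sum_{i=1}^n\Big[\mathbb E_{s'\sim P_M(\cdot|s^{(i)}_{h-1},a^{(i)}_{h-1})}f(s^{(i)}_{h-1},a^{(i)}_{h-1},s')-f(s^{(i)}_{h-1},a^{(i)}_{h-1},s^{(i)}_h)\Big].$$ Here $\widetilde{\mathcal F}=\{\pm f_{\pi,M,h}:\pi\in\Pi,M\in\mathcal M,h\le H\}$, and $f_{\pi,M,h}$ is any maximizer of $\mathbb E_{s\sim P^{\pi,h-1}_{M^\star},a\sim U(\mathcal A)}\big[\mathbb E_{s'\sim P_M(\cdot|s,a)}f(s,a,s')-\mathbb E_{s'\sim P_{M^\star}(\cdot|s,a)}f(s,a,s')\big]$ over all $f$ with $\|f\|_\infty\le1$. Otherwise choose any $\tilde M\in\mathcal M_t$, halt and return a maximizer of $v_{\tilde M}$ over $\Pi$. All maximizations over $\Pi$ are exact, with arbitrary tie-breaking. **Theorem.**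 There is a universal constant $c>0$ such that for every $C\ge c$ there is a constant $C'>0$, depending only on $C$, with the following property. Assume $M^\star\in\mathcal M$ and that $\Pi$ contains an optimal policy for every model in $\mathcal M$. Let $\epsilon,\delta\in(0,1]$, $$\phi=\frac{\epsilon}{24H^2|\mathcal A|^2\sqrt d},\qquad T=\frac{Hd\log(\beta/(2\phi))}{\log(5/3)},$$ suppose $T>0$, and run DREEM with an integer $n=\Theta\big(H^4|\mathcal A|^4d\,\log(T|\mathcal M||\Pi|/\delta)/\epsilon^2\big)$, precisely $$c\,\frac{H^4|\mathcal A|^4d\log(T|\mathcal M||\Pi|/\delta)}{\epsilon^2}\le n\le C\,\frac{H^4|\mathcal A|^4d\log(T|\mathcal M||\Pi|/\delta)}{\epsilon^2}.$$ Then with probability at least $1-\delta$ the algorithm halts and returns a policy $\hat\pi$ with $v_{M^\star}(\hat\pi)\ge\max_\pi v_{M^\star}(\pi)-\epsilon$, and the total number of trajectories collected is at most $$C'\,\frac{H^5d^2|\mathcal A|^4}{\epsilon^2}\,\log\Big(\frac{T|\mathcal M||\Pi|}{\delta}\Big)\log\Big(\frac{\beta}{2\phi}\Big)=\tilde O\Big(\frac{H^5d^2|\mathcal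 A|^4}{\epsilon^2}\log\frac{T|\mathcal M||\Pi|}{\delta}\Big).$$ -/

import Mathlib

namespace DREEM

noncomputable section

universe u v

/-- A transition model: state-action pairs are mapped to distributions over next states. -/
abbrev Model (S : Type u) (A : Type v) := S → A → PMF S

/-- A (possibly time-dependent) randomized Markov policy: at time `h` in state `s` the action is
drawn from `π h s`. -/
abbrev Policy (S : Type u) (A : Type v) := ℕ → S → PMF A

/-- The environment: initial state distribution, true transition model, known reward function
with values in `[0, 1]`. -/
structure Env (S : Type u) (A : Type v) where
  init : PMF S
  Mstar : Model S A
  R : S → ℝ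
  R_nonneg : ∀ s, 0 ≤ R s
  R_le_one : ∀ s, R s ≤ 1

/-- What one trajectory contributes to the estimates: for every step `h`, a triple
(state at time `h`, action, state at time `h + 1`). -/
abbrev Trajectory (S : Type u) (A : Type v) (H : ℕ) := Fin H → S × A × S

/-- A data set of `n` trajectories. -/
abbrev Dataset (S : Type u) (A : Type v) (H n : ℕ) := Fin n → Trajectory S A H

/-- The replay buffer: the data sets collected so far with the policies that collected them,
most recent first. -/
abbrev Buffer (S : Type u) (A : Type v) (H n : ℕ) := List (Policy S A × Dataset S A H n)

/-- The `ℓ¹` distance `∑ₓ |p x - q x|`, which is the supremum of `E_p f - E_q f` over `|f| ≤ 1`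
(the normalization of total variation used throughout). -/
def tvDist {α : Type*} (p q : PMF α) : ℝ := ∑' x, |(p x).toReal - (q x).toReal|

/-- `n` independent draws from `p`. -/
def iid {α : Type*} (p : PMF α) : (n : ℕ) → PMF (Fin n → α)
  | 0 => PMF.pure Fin.elim0
  | n + 1 => p.bind fun x => (iid p n).bind fun y => PMF.pure (Fin.cons x y)

section Setting

variable {S : Type u} {A : Type v} [Fintype A] [Nonempty A]

/-- Distribution of the state at time `h` when actions are drawn from `π` and transitions from
`M`; time `0` is the initial state. -/
def stateDist (E : Env S A) (M : Model S A) (π : Policy S A) : ℕ → PMF S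
  | 0 => E.init
  | h + 1 => (stateDist E M π h).bind fun s => (π h s).bind fun a => M s a

/-- Expected total reward of `π` under the model `M`, over times `1, …, H`. -/
def value (E : Env S A) (H : ℕ) (M : Model S A) (π : Policy S A) : ℝ :=
  ∑ h ∈ Finset.range H, ∑' s, (stateDist E M π (h + 1) s).toReal * E.R s

/-- `π` is optimal for the model `M`. -/
def IsOptimal (E : Env S A) (H : ℕ) (M : Model S A) (π : Policy S A) : Prop :=
  ∀ π' : Policy S A, value E H M π' ≤ value E H M π

/-- Predicted disagreement between `M` and `M'` on the transition from time `h` to time `h + 1`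
(time step `h + 1` when steps are numbered from `1`), the last action being uniform. -/
def disagreement (E : Env S A) (π : Policy S A) (M M' : Model S A) (h : ℕ) : ℝ :=
  ∑' s, ∑ a, ∑' s',
    |(M s a s').toReal * (stateDist E M π h s).toReal * (Fintype.card A : ℝ)⁻¹
      - (M' s a s').toReal * (stateDist E M' π h s).toReal * (Fintype.card A : ℝ)⁻¹|

/-- Objective of the exploration policy: the maximal total disagreement over pairs of models. -/
def vExplore (E : Env S A) (H : ℕ) (π : Policy S A) (N : Finset (Model S A)) : ℝ :=
  ⨆ p : N × N, ∑ h ∈ Finset.range H, disagreement E π p.1.1 p.2.1 h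

/-- Misfit of `M` discovered by `π` on the transition from time `h` to time `h + 1`. -/
def misfit (E : Env S A) (π : Policy S A) (M : Model S A) (h : ℕ) : ℝ :=
  ∑' s, (stateDist E E.Mstar π h s).toReal *
    ∑ a, (Fintype.card A : ℝ)⁻¹ * tvDist (M s a) (E.Mstar s a)

/-- The model misfit matrix of step `h`. -/
def misfitMatrix (E : Env S A) (Pi : Finset (Policy S A)) (Ms : Finset (Model S A)) (h : ℕ) :
    Matrix Pi Ms ℝ :=
  Matrix.of fun π M => misfit E π.1 M.1 h

/-- `B = U Vᵀ` with inner dimension `k`, and `‖uᵢ‖ ‖vⱼ‖ ≤ β` for all pairs of rows. -/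
def HasFactorization {m n : Type*} (B : Matrix m n ℝ) (β : ℝ) (k : ℕ) : Prop :=
  ∃ (U : m → EuclideanSpace ℝ (Fin k)) (V : n → EuclideanSpace ℝ (Fin k)),
    (∀ i j, B i j = inner ℝ (U i) (V j)) ∧ ∀ i j, ‖U i‖ * ‖V j‖ ≤ β

/-- The norm-constrained rank `rank(B, β)`: the least inner dimension of such a factorization,
and `⊤` if there is none. -/
def normRank {m n : Type*} (B : Matrix m n ℝ) (β : ℝ) : ℕ∞ :=
  ⨅ (k : ℕ) (_ : HasFactorization B β k), (k : ℕ∞)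

/-- The law of a sample for step `h`: roll in with `π` in the true environment up to time `h`,
take a uniformly random action, observe the next state. -/
def sampleLaw (E : Env S A) (π : Policy S A) (h : ℕ) : PMF (S × A × S) :=
  (stateDist E E.Mstar π h).bind fun s =>
    (PMF.uniformOfFintype A).bind fun a => (E.Mstar s a).map fun s' => (s, a, s')

/-- `τ π` is an admissible law for a trajectory collected with `π`: for every step `h` its sample
has the law `sampleLaw E π h`. The joint law over different steps is left free. -/
def IsTrajectoryLaw (E : Env S A) (H : ℕ) (τ : Policy S A → PMF (Trajectory S A H)) : Prop :=
  ∀ (π : Policy S A) (h : Fin H), (τ π).map (fun x => x h) = sampleLaw E π h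

/-- `E_{s, a} [ E_{s' ∼ M(s,a)} f(s,a,s') - E_{s' ∼ M⋆(s,a)} f(s,a,s') ]` for `s` the state at
time `h` under `π` in the true environment and `a` uniform. -/
def testGap (E : Env S A) (π : Policy S A) (M : Model S A) (h : ℕ) (f : S × A × S → ℝ) : ℝ :=
  ∑' s, (stateDist E E.Mstar π h s).toReal * ∑ a, (Fintype.card A : ℝ)⁻¹ *
    ((∑' s', (M s a s').toReal * f (s, a, s')) - ∑' s', (E.Mstar s a s').toReal * f (s, a, s'))

/-- `F π M h` maximizes `testGap` among all functions with sup norm at most `1`. -/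
def IsTestFamily (E : Env S A) (H : ℕ) (Pi : Finset (Policy S A)) (Ms : Finset (Model S A))
    (F : Policy S A → Model S A → Fin H → S × A × S → ℝ) : Prop :=
  ∀ π ∈ Pi, ∀ M ∈ Ms, ∀ h : Fin H, (∀ x, |F π M h x| ≤ 1) ∧
    ∀ f : S × A × S → ℝ, (∀ x, |f x| ≤ 1) → testGap E π M h f ≤ testGap E π M h (F π M h)

/-- The finite set of test functions `± F π M h`. -/
def testSet {H : ℕ} (Pi : Finset (Policy S A)) (Ms : Finset (Model S A))
    (F : Policy S A → Model S A → Fin H → S × A × S → ℝ) : Set (S × A × S → ℝ) :=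
  {f | ∃ π ∈ Pi, ∃ M ∈ Ms, ∃ h : Fin H, f = F π M h ∨ f = -F π M h}

/-- Empirical misfit of `M` at step `h` computed from a data set with the test functions `Ft`. -/
def empMisfit {H n : ℕ} (Ft : Set (S × A × S → ℝ)) (D : Dataset S A H n) (M : Model S A)
    (h : Fin H) : ℝ :=
  sSup ((fun f : S × A × S → ℝ => (n : ℝ)⁻¹ * ∑ i : Fin n,
    ((∑' s', (M (D i h).1 (D i h).2.1 s').toReal * f ((D i h).1, (D i h).2.1, s'))
      - f (D i h))) '' Ft)

open Classical in
/-- The elimination step: keep the models with empirical misfit at most `φ` at every step. -/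
def updateModelSet {H n : ℕ} (Ft : Set (S × A × S → ℝ)) (φ : ℝ) (N : Finset (Model S A))
    (D : Dataset S A H n) : Finset (Model S A) :=
  N.filter fun M => ∀ h : Fin H, empMisfit Ft D M h ≤ φ

/-- The choices made by the algorithm; ties may be broken using the whole replay buffer. -/
structure Planner (S : Type u) (A : Type v) (H n : ℕ) where
  explore : Buffer S A H n → Finset (Model S A) → Policy S A
  choose : Buffer S A H n → Finset (Model S A) → Model S A
  exploit : Buffer S A H n → Model S A → Policy S A

/-- The policy optimizations are exact, and the chosen model belongs to the current model set. -/
structure Planner.IsExact {H n : ℕ} (P : Planner S A H n) (E : Env S A)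
    (Pi : Finset (Policy S A)) (Ms : Finset (Model S A)) : Prop where
  explore_mem : ∀ b, ∀ N ⊆ Ms, N.Nonempty → P.explore b N ∈ Pi
  explore_max : ∀ b, ∀ N ⊆ Ms, N.Nonempty → ∀ π ∈ Pi,
    vExplore E H π N ≤ vExplore E H (P.explore b N) N
  choose_mem : ∀ b, ∀ N ⊆ Ms, N.Nonempty → P.choose b N ∈ N
  exploit_mem : ∀ b, ∀ M ∈ Ms, P.exploit b M ∈ Pi
  exploit_max : ∀ b, ∀ M ∈ Ms, ∀ π ∈ Pi, value E H M π ≤ value E H M (P.exploit b M)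

/-- State of the algorithm between two iterations of its main loop: still running, with its
replay buffer and current model set, or halted, with its final buffer and output policy. -/
inductive State (S : Type u) (A : Type v) (H n : ℕ) where
  | running (b : Buffer S A H n) (N : Finset (Model S A))
  | halted (b : Buffer S A H n) (π : Policy S A)

open Classical in
/-- One iteration of the main loop. If the model set has become empty, no model can be chosen and
the algorithm never produces an output. -/
def step {H n : ℕ} (E : Env S A) (τ : Policy S A → PMF (Trajectory S A H))
    (Ft : Set (S × A × S → ℝ)) (P : Planner S A H n) (ε φ : ℝ) :
    State S A H n → PMF (State S A H n)
  | .halted b π => PMF.pure (.halted b π)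
  | .running b N =>
    if N.Nonempty then
      if ε / (Fintype.card A : ℝ) < vExplore E H (P.explore b N) N then
        (iid (τ (P.explore b N)) n).map fun D =>
          .running ((P.explore b N, D) :: b) (updateModelSet Ft φ N D)
      else PMF.pure (.halted b (P.exploit b (P.choose b N)))
    else PMF.pure (.running b N)

/-- The law of the state after `k` iterations, started with the model set `Ms` and an empty
replay buffer. -/
def run {H n : ℕ} (E : Env S A) (τ : Policy S A → PMF (Trajectory S A H))
    (Ft : Set (S × A × S → ℝ)) (P : Planner S A H n) (ε φ : ℝ) (Ms : Finset (Model S A)) :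
    ℕ → PMF (State S A H n)
  | 0 => PMF.pure (.running [] Ms)
  | k + 1 => (run E τ Ft P ε φ Ms k).bind (step E τ Ft P ε φ)

/-- The probability that the algorithm halts with a final replay buffer and an output policy that
satisfy `G`. Halted states are absorbing, so the supremum over the number of iterations is the
limit. -/
def haltProb {H n : ℕ} (E : Env S A) (τ : Policy S A → PMF (Trajectory S A H))
    (Ft : Set (S × A × S → ℝ)) (P : Planner S A H n) (ε φ : ℝ) (Ms : Finset (Model S A))
    (G : Buffer S A H n → Policy S A → Prop) : ENNReal :=
  ⨆ k : ℕ, (run E τ Ft P ε φ Ms k).toOuterMeasure {x | ∃ b π, x = .halted b π ∧ G b π}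

/-- Number of trajectories in the replay buffer: `n` for every data set. -/
def numTrajectories {H n : ℕ} (b : Buffer S A H n) : ℕ := n * b.length

end Setting

/-- The threshold `φ = ε / (24 H² |𝒜|² √d)`. -/
def threshold (H a d : ℕ) (ε : ℝ) : ℝ := ε / (24 * (H : ℝ) ^ 2 * (a : ℝ) ^ 2 * √(d : ℝ))

/-- `T = H d log(β / (2φ)) / log(5/3)`. -/
def roundBound (H a d : ℕ) (ε β : ℝ) : ℝ :=
  (H : ℝ) * d * Real.log (β / (2 * threshold H a d ε)) / Real.log (5 / 3)

end

end DREEM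

/-!
The value gap between two models is controlled by their predicted disagreement, so once no policy
of `Pi` sees much disagreement among the surviving models, all of them, the true one included,
agree up to `ε / 2` on the value of every policy of `Pi`, and a policy that is optimal for one of
them is `ε`-optimal. If instead the exploration policy sees large disagreement, then telescoping
over time shows that some surviving model has misfit above `w = 12 φ √d` under this policy at some
step. By Hoeffding's inequality and a union bound a fresh data set estimates every `testGap` up to
`φ`, and the update then removes all models with misfit above `2 φ` under this policy, but never the
true one.

Hence the successive witnesses single out, in each misfit matrix, a sequence of entries that are
larger than `6 √d` times the bound `2 φ` valid for the later models. In a factorization of dimension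
`d`, every such entry cuts a thin slab through an ellipsoid that contains all remaining column
vectors; the ellipsoid is replaced by one of at most half the volume, and since the volume stays
bounded below, there are at most `d log (β / (2 φ)) / log 2` witnesses per step.
-/

namespace DREEM

section Ellipsoid

open Matrix

/-- A sequence of entries of `B`, most recent first, each of them larger than `w` although all
earlier rows are at most `η` in absolute value in its column. The length of such sequences measures
how often a large entry can come as a surprise. -/
structure IsEluderSequence {m n : Type*} (B : Matrix m n ℝ) (η w : ℝ) (l : List (m × n)) :
    Prop where
  large : ∀ x ∈ l, w < B x.1 x.2
  pairwise : l.Pairwise fun x y => |B y.1 x.2| ≤ η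

variable {ι m n : Type*} [Fintype ι]

theorem det_le_trace_div_card_pow [DecidableEq ι] {Q : Matrix ι ι ℝ} (hQ : Q.PosSemidef) :
    Q.det ≤ (Q.trace / Fintype.card ι) ^ Fintype.card ι := by
  rcases isEmpty_or_nonempty ι with h | h
  · simp
  have hdet : Q.det = ∏ i, hQ.isHermitian.eigenvalues i := by
    simpa using hQ.isHermitian.det_eq_prod_eigenvalues
  have htrace : Q.trace = ∑ i, hQ.isHermitian.eigenvalues i := by
    simpa using hQ.isHermitian.trace_eq_sum_eigenvalues
  have amgm := Real.geom_mean_le_arith_mean Finset.univ (fun _ => 1)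
    hQ.isHermitian.eigenvalues (fun _ _ => zero_le_one) (by simp [Fintype.card_pos])
    fun i _ => hQ.eigenvalues_nonneg i
  simp only [Real.rpow_one, Finset.sum_const, Finset.card_univ, nsmul_eq_mul, mul_one, one_mul,
    ← hdet, ← htrace] at amgm
  have hdet0 : 0 ≤ Q.det := hQ.det_nonneg
  calc Q.det = (Q.det ^ ((Fintype.card ι : ℝ)⁻¹)) ^ Fintype.card ι :=
        (Real.rpow_inv_natCast_pow hdet0 Fintype.card_ne_zero).symm
    _ ≤ _ := by gcongr

theorem sq_dotProduct_le_mul_inv [DecidableEq ι] {Q : Matrix ι ι ℝ} (hQ : Q.PosDef) (u v : ι → ℝ) :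
    (u ⬝ᵥ v) ^ 2 ≤ (u ⬝ᵥ Q⁻¹ *ᵥ u) * (v ⬝ᵥ Q *ᵥ v) := by
  have hu : Q *ᵥ (Q⁻¹ *ᵥ u) = u := by
    rw [mulVec_mulVec, mul_nonsing_inv _ hQ.det_pos.ne'.isUnit, one_mulVec]
  have hsymm : Qᵀ = Q := by simpa using hQ.isHermitian.eq
  have hcross : (Q⁻¹ *ᵥ u) ⬝ᵥ Q *ᵥ v = u ⬝ᵥ v := by
    rw [dotProduct_mulVec, ← mulVec_transpose, hsymm, hu]
  have hquad : ∀ t : ℝ, 0 ≤ (v ⬝ᵥ Q *ᵥ v) * (t * t) + 2 * (u ⬝ᵥ v) * t + u ⬝ᵥ Q⁻¹ *ᵥ u := by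
    intro t
    have h := hQ.posSemidef.dotProduct_mulVec_nonneg (Q⁻¹ *ᵥ u + t • v)
    simp only [star_trivial, mulVec_add, mulVec_smul, add_dotProduct, dotProduct_add,
      smul_dotProduct, dotProduct_smul, smul_eq_mul, hu, hcross, dotProduct_comm v u,
      dotProduct_comm (Q⁻¹ *ᵥ u) u] at h
    linarith
  have hdiscrim := discrim_le_zero hquad
  rw [discrim] at hdiscrim
  linarith

theorem det_add_smul_vecMulVec [DecidableEq ι] {Q : Matrix ι ι ℝ} (hQ : IsUnit Q.det)
    (u : ι → ℝ) (r : ℝ) :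
    (Q + r • vecMulVec u u).det = Q.det * (1 + r * (u ⬝ᵥ Q⁻¹ *ᵥ u)) := by
  have h := det_add_replicateCol_mul_replicateRow (ι := Unit) hQ (r • u) u
  rw [← vecMulVec_eq, smul_vecMulVec] at h
  rw [h, det_unique (n := Unit), Matrix.add_apply, one_apply_eq, Matrix.mul_assoc,
    ← replicateCol_mulVec, replicateRow_mul_replicateCol_apply, mulVec_smul, dotProduct_smul,
    smul_eq_mul]

/-- The matrix of an ellipsoid that contains the part of the ellipsoid `{x | xᵀ Q x ≤ 1}` lying in
the slab `{x | |uᵀ x| ≤ 1}`, namely the convex combination of `Q` and `u uᵀ` with weights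
proportional to `1` and `q`. -/
noncomputable def slabCut (Q : Matrix ι ι ℝ) (u : ι → ℝ) (q : ℝ) : Matrix ι ι ℝ :=
  (1 + q)⁻¹ • (Q + q • vecMulVec u u)

variable {Q : Matrix ι ι ℝ} {u x : ι → ℝ} {q t : ℝ}

omit [Fintype ι] in
theorem posDef_slabCut [Finite ι] (hQ : Q.PosDef) (hq : 0 ≤ q) : (slabCut Q u q).PosDef := by
  have hu : (vecMulVec u u).PosSemidef := by simpa using posSemidef_vecMulVec_self_star u
  exact (hQ.add_posSemidef (hu.smul hq)).smul (by positivity)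

theorem trace_slabCut_le (hq : 0 ≤ q) (hQ : Q.trace ≤ t) (hu : u ⬝ᵥ u ≤ t) :
    (slabCut Q u q).trace ≤ t := by
  rw [slabCut, trace_smul, trace_add, trace_smul, trace_vecMulVec, smul_eq_mul, smul_eq_mul,
    inv_mul_le_iff₀ (by positivity)]
  linarith [mul_le_mul_of_nonneg_left hu hq]

theorem dotProduct_slabCut_mulVec_le_one (hq : 0 ≤ q) (hx : x ⬝ᵥ Q *ᵥ x ≤ 1)
    (hux : |u ⬝ᵥ x| ≤ 1) : x ⬝ᵥ slabCut Q u q *ᵥ x ≤ 1 := by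
  have hsq : x ⬝ᵥ vecMulVec u u *ᵥ x = (u ⬝ᵥ x) ^ 2 := by
    rw [vecMulVec_mulVec, dotProduct_smul, dotProduct_comm x u]
    simp [sq]
  have hux' : (u ⬝ᵥ x) ^ 2 ≤ 1 := (sq_le_one_iff_abs_le_one _).2 hux
  rw [slabCut, smul_mulVec, dotProduct_smul, add_mulVec, dotProduct_add, smul_mulVec,
    dotProduct_smul, hsq, smul_eq_mul, smul_eq_mul, inv_mul_le_iff₀ (by positivity)]
  linarith [mul_le_mul_of_nonneg_left hux' hq]

theorem det_slabCut [DecidableEq ι] (hQ : Q.PosDef) :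
    (slabCut Q u q).det =
      Q.det * (1 + q * (u ⬝ᵥ Q⁻¹ *ᵥ u)) / (1 + q) ^ Fintype.card ι := by
  rw [slabCut, det_smul, det_add_smul_vecMulVec hQ.det_pos.ne'.isUnit, inv_pow, inv_mul_eq_div]

theorem one_add_pow_le_five_div_four {k : ℕ} (hq : 0 ≤ q) (hkq : k * q ≤ 1 / 9) :
    (1 + q) ^ k ≤ 5 / 4 :=
  calc (1 + q) ^ k ≤ Real.exp q ^ k := by
        gcongr
        linarith [Real.add_one_le_exp q]
    _ = Real.exp (k * q) := (Real.exp_nat_mul q k).symm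
    _ ≤ Real.exp (1 / 9) := Real.exp_le_exp.2 hkq
    _ ≤ 1 / (1 - 1 / 9) := Real.exp_bound_div_one_sub_of_interval (by norm_num) (by norm_num)
    _ ≤ 5 / 4 := by norm_num

-- The slab is thin compared with the width `w` of the ellipsoid in the direction `u`: with
-- `q = 4 / w` the determinant is multiplied by `1 + q w = 5`, up to a normalization below `5 / 4`.
theorem exists_four_mul_det_le_det_slabCut [DecidableEq ι] (hQ : Q.PosDef)
    (hx : x ⬝ᵥ Q *ᵥ x ≤ 1) (hux : 6 * √(Fintype.card ι) < u ⬝ᵥ x) :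
    ∃ q, 0 ≤ q ∧ 4 * Q.det ≤ (slabCut Q u q).det := by
  set w := u ⬝ᵥ Q⁻¹ *ᵥ u with hw
  have hw0 : 0 ≤ w := hQ.inv.posSemidef.dotProduct_mulVec_nonneg u
  have hwidth : 36 * Fintype.card ι < w :=
    calc 36 * (Fintype.card ι : ℝ) = (6 * √(Fintype.card ι)) ^ 2 := by
          rw [mul_pow, Real.sq_sqrt (Nat.cast_nonneg _)]
          norm_num
      _ < (u ⬝ᵥ x) ^ 2 := by gcongr
      _ ≤ w * (x ⬝ᵥ Q *ᵥ x) := sq_dotProduct_le_mul_inv hQ u x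
      _ ≤ w := mul_le_of_le_one_right hw0 hx
  have hwpos : 0 < w := lt_of_le_of_lt (by positivity) hwidth
  have hnormalization : (1 + 4 / w) ^ Fintype.card ι ≤ 5 / 4 := by
    refine one_add_pow_le_five_div_four (by positivity) ?_
    rw [mul_div_assoc', div_le_div_iff₀ hwpos (by norm_num)]
    linarith
  refine ⟨4 / w, by positivity, ?_⟩
  rw [det_slabCut hQ, ← hw, div_mul_cancel₀ _ hwpos.ne', le_div_iff₀ (by positivity)]
  linarith [mul_le_mul_of_nonneg_left hnormalization hQ.det_pos.le]

theorem IsEluderSequence.exists_posDef [DecidableEq ι] {U : m → ι → ℝ} {V : n → ι → ℝ}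
    {l : List (m × n)}
    (hl : IsEluderSequence (.of fun i j => U i ⬝ᵥ V j) 1 (6 * √(Fintype.card ι)) l) {R : ℝ}
    (hR : 0 < R) (ht : Fintype.card ι / R ^ 2 ≤ t) (hU : ∀ x ∈ l, U x.1 ⬝ᵥ U x.1 ≤ t)
    (hV : ∀ x ∈ l, V x.2 ⬝ᵥ V x.2 ≤ R ^ 2) :
    ∃ Q : Matrix ι ι ℝ, Q.PosDef ∧ Q.trace ≤ t ∧
      4 ^ l.length ≤ Q.det * (R ^ 2) ^ Fintype.card ι ∧
      ∀ v, v ⬝ᵥ v ≤ R ^ 2 → (∀ x ∈ l, |U x.1 ⬝ᵥ v| ≤ 1) → v ⬝ᵥ Q *ᵥ v ≤ 1 := by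
  induction l with
  | nil =>
    refine ⟨(R ^ 2)⁻¹ • 1, PosDef.one.smul (by positivity), ?_, ?_, fun v hv _ => ?_⟩
    · simpa [div_eq_inv_mul] using ht
    · simp [hR.ne']
    · rwa [smul_mulVec, one_mulVec, dotProduct_smul, smul_eq_mul, inv_mul_le_iff₀ (by positivity),
        mul_one]
  | cons a l ih =>
    obtain ⟨hlarge, hpair⟩ := hl
    rw [List.pairwise_cons] at hpair
    rw [List.forall_mem_cons] at hlarge hU hV
    obtain ⟨Q, hQ, htrace, hdet, hball⟩ := ih ⟨hlarge.2, hpair.2⟩ hU.2 hV.2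
    obtain ⟨q, hq, hcut⟩ :=
      exists_four_mul_det_le_det_slabCut hQ (hball _ hV.1 hpair.1) hlarge.1
    refine ⟨slabCut Q (U a.1) q, posDef_slabCut hQ hq, trace_slabCut_le hq htrace hU.1, ?_,
      fun v hv hslab => ?_⟩
    · rw [List.length_cons, pow_succ']
      calc 4 * 4 ^ l.length ≤ 4 * (Q.det * (R ^ 2) ^ Fintype.card ι) := by gcongr
        _ = 4 * Q.det * (R ^ 2) ^ Fintype.card ι := by ring
        _ ≤ _ := by gcongr
    · rw [List.forall_mem_cons] at hslab
      exact dotProduct_slabCut_mulVec_le_one hq (hball v hv hslab.2) hslab.1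

theorem IsEluderSequence.two_pow_length_le [Nonempty ι] {U : m → ι → ℝ} {V : n → ι → ℝ}
    {l : List (m × n)}
    (hl : IsEluderSequence (.of fun i j => U i ⬝ᵥ V j) 1 (6 * √(Fintype.card ι)) l) {B R : ℝ}
    (hR : 0 < R) (hBR : 1 ≤ B * R) (hU : ∀ x ∈ l, U x.1 ⬝ᵥ U x.1 ≤ B ^ 2)
    (hV : ∀ x ∈ l, V x.2 ⬝ᵥ V x.2 ≤ R ^ 2) :
    2 ^ l.length ≤ (B * R) ^ Fintype.card ι := by
  classical
  have hcard : (1 : ℝ) ≤ Fintype.card ι := Nat.one_le_cast.2 Fintype.card_pos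
  have hinitial : Fintype.card ι / R ^ 2 ≤ Fintype.card ι * B ^ 2 := by
    rw [div_le_iff₀ (by positivity), mul_assoc, ← mul_pow]
    exact le_mul_of_one_le_right (by positivity) (one_le_pow₀ hBR)
  obtain ⟨Q, hQ, htrace, hdet, -⟩ := hl.exists_posDef hR hinitial
    (fun x hx => (hU x hx).trans (le_mul_of_one_le_left (sq_nonneg B) hcard)) hV
  have hdet_le : Q.det ≤ (B ^ 2) ^ Fintype.card ι := by
    refine (det_le_trace_div_card_pow hQ.posSemidef).trans ?_
    have := hQ.posSemidef.trace_nonneg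
    gcongr
    rwa [div_le_iff₀' (by positivity)]
  refine le_of_sq_le_sq ?_ (by positivity)
  calc ((2 : ℝ) ^ l.length) ^ 2 = 4 ^ l.length := by rw [← pow_mul', pow_mul]; norm_num
    _ ≤ Q.det * (R ^ 2) ^ Fintype.card ι := hdet
    _ ≤ (B ^ 2) ^ Fintype.card ι * (R ^ 2) ^ Fintype.card ι := by gcongr
    _ = ((B * R) ^ Fintype.card ι) ^ 2 := by ring

end Ellipsoid

section NormRank

variable {m n : Type*} {B : Matrix m n ℝ} {β : ℝ}

theorem exists_hasFactorization_of_normRank_le {d : ℕ} (h : normRank B β ≤ d) :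
    ∃ k ≤ d, HasFactorization B β k := by
  have hlt : normRank B β < (d + 1 : ℕ) := h.trans_lt (by exact_mod_cast d.lt_succ_self)
  simp only [normRank, iInf_lt_iff] at hlt
  obtain ⟨k, hk, hkd⟩ := hlt
  exact ⟨k, Nat.lt_succ_iff.1 (by exact_mod_cast hkd), hk⟩

theorem HasFactorization.apply_le {k : ℕ} (h : HasFactorization B β k) (i : m) (j : n) :
    B i j ≤ β := by
  obtain ⟨U, V, hUV, hβ⟩ := h
  rw [hUV]
  exact (real_inner_le_norm _ _).trans (hβ i j)

theorem IsEluderSequence.mono {η w w' : ℝ} {l : List (m × n)} (hl : IsEluderSequence B η w l)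
    (hw : w' ≤ w) : IsEluderSequence B η w' l :=
  ⟨fun x hx => hw.trans_lt (hl.large x hx), hl.pairwise⟩

theorem IsEluderSequence.inv_smul {η w : ℝ} {l : List (m × n)}
    (hl : IsEluderSequence B η (η * w) l) (hη : 0 < η) :
    IsEluderSequence (η⁻¹ • B) 1 w l := by
  refine ⟨fun x hx => ?_, hl.pairwise.imp fun h => ?_⟩
  · rw [Matrix.smul_apply, smul_eq_mul, lt_inv_mul_iff₀ hη]
    exact hl.large x hx
  · rwa [Matrix.smul_apply, smul_eq_mul, abs_mul, abs_of_pos (inv_pos.2 hη),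
      inv_mul_le_iff₀ hη, mul_one]

-- Only the products `‖uᵢ‖ ‖vⱼ‖` are bounded: taking for `B` the largest `‖uᵢ‖` of the sequence,
-- every `‖vⱼ‖` is at most `β / B`.
theorem IsEluderSequence.two_pow_length_le_of_inner {ι : Type*} [Fintype ι]
    {U : m → EuclideanSpace ℝ ι} {V : n → EuclideanSpace ℝ ι} {l : List (m × n)}
    (hl : IsEluderSequence (.of fun i j => inner ℝ (U i) (V j)) 1 (6 * √(Fintype.card ι)) l)
    (hβ : 1 ≤ β) (hUV : ∀ i j, ‖U i‖ * ‖V j‖ ≤ β) : 2 ^ l.length ≤ β ^ Fintype.card ι := by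
  rcases eq_or_ne l [] with rfl | hne
  · simpa using one_le_pow₀ hβ
  classical
  have hinner : ∀ u v : EuclideanSpace ℝ ι, inner ℝ u v = u.ofLp ⬝ᵥ v.ofLp := fun u v => by
    simp [EuclideanSpace.inner_eq_star_dotProduct, dotProduct_comm]
  have hnorm : ∀ u : EuclideanSpace ℝ ι, u.ofLp ⬝ᵥ u.ofLp = ‖u‖ ^ 2 := fun u => by
    rw [← hinner, real_inner_self_eq_norm_sq]
  obtain ⟨x, hx, hmax⟩ := l.toFinset.exists_max_image (fun x => ‖U x.1‖)
    ((List.toFinset_nonempty_iff l).2 hne)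
  simp only [List.mem_toFinset] at hx hmax
  have hUx : U x.1 ≠ 0 := fun h => by
    have := hl.large x hx
    simp only [Matrix.of_apply, h, inner_zero_left] at this
    exact absurd this (not_lt.2 (by positivity))
  have hpos : 0 < ‖U x.1‖ := norm_pos_iff.2 hUx
  have : Nonempty ι := not_isEmpty_iff.1 fun _ => hUx (Subsingleton.elim _ _)
  simp only [hinner] at hl
  have hproduct : ‖U x.1‖ * (β / ‖U x.1‖) = β := mul_div_cancel₀ _ hpos.ne'
  have h := hl.two_pow_length_le (B := ‖U x.1‖) (R := β / ‖U x.1‖) (by positivity)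
    (hβ.trans_eq hproduct.symm)
    (fun y hy => by rw [hnorm]; exact pow_le_pow_left₀ (norm_nonneg _) (hmax y hy) 2)
    (fun y _ => by
      rw [hnorm]
      exact pow_le_pow_left₀ (norm_nonneg _) ((le_div_iff₀' hpos).2 (hUV _ _)) 2)
  rwa [hproduct] at h

theorem IsEluderSequence.length_mul_log_two_le {d : ℕ} {η : ℝ} {l : List (m × n)}
    (hl : IsEluderSequence B η (6 * η * √d) l) (hη : 0 < η) (hηβ : η ≤ β)
    (hB : normRank B β ≤ d) : l.length * Real.log 2 ≤ d * Real.log (β / η) := by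
  obtain ⟨k, hkd, U, V, hUV, hβ⟩ := exists_hasFactorization_of_normRank_le hB
  have hscaled :
      IsEluderSequence (.of fun i j => inner ℝ (η⁻¹ • U i) (V j)) 1 (6 * √k) l := by
    have hw : η * (6 * √k) ≤ 6 * η * √d :=
      calc η * (6 * √k) = 6 * η * √k := by ring
        _ ≤ 6 * η * √d := by gcongr
    convert (hl.mono hw).inv_smul hη using 1
    ext i j
    rw [Matrix.of_apply, Matrix.smul_apply, hUV, real_inner_smul_left, smul_eq_mul]
  have hratio : 1 ≤ β / η := (one_le_div hη).2 hηβ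
  have hnorm : ∀ i j, ‖η⁻¹ • U i‖ * ‖V j‖ ≤ β / η := fun i j => by
    rw [norm_smul, norm_inv, Real.norm_of_nonneg hη.le, mul_assoc, inv_mul_eq_div]
    exact div_le_div_of_nonneg_right (hβ i j) hη.le
  have hcount : (2 : ℝ) ^ l.length ≤ (β / η) ^ k := by
    have h := IsEluderSequence.two_pow_length_le_of_inner (by rwa [Fintype.card_fin]) hratio hnorm
    rwa [Fintype.card_fin] at h
  calc l.length * Real.log 2 = Real.log (2 ^ l.length) := (Real.log_pow _ _).symm
    _ ≤ Real.log ((β / η) ^ k) := Real.log_le_log (by positivity) hcount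
    _ = k * Real.log (β / η) := Real.log_pow _ _
    _ ≤ d * Real.log (β / η) := by
        have := Real.log_nonneg hratio
        gcongr

end NormRank

section Expectation

variable {α β : Type*} {C C' : ℝ}

/-- The expectation of `g` under `p`. It is meant for bounded `g`, for which the series converges
absolutely. -/
noncomputable def expectation (p : PMF α) (g : α → ℝ) : ℝ := ∑' x, (p x).toReal * g x

theorem hasSum_toReal (p : PMF α) : HasSum (fun x => (p x).toReal) 1 := by
  have h := (ENNReal.summable_toReal p.tsum_coe_ne_top).hasSum
  rwa [← ENNReal.tsum_toReal_eq p.apply_ne_top, p.tsum_coe, ENNReal.toReal_one] at h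

theorem summable_toReal_mul (p : PMF α) {g : α → ℝ} (hg : ∀ x, |g x| ≤ C) :
    Summable fun x => (p x).toReal * g x := by
  refine Summable.of_norm_bounded ((hasSum_toReal p).summable.mul_right C) fun x => ?_
  rw [norm_mul, Real.norm_eq_abs, Real.norm_eq_abs, abs_of_nonneg ENNReal.toReal_nonneg]
  exact mul_le_mul_of_nonneg_left (hg x) ENNReal.toReal_nonneg

theorem toReal_apply_le_one (p : PMF α) (x : α) : (p x).toReal ≤ 1 :=
  ENNReal.toReal_le_of_le_ofReal zero_le_one (by simpa using p.coe_le_one x)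

theorem abs_toReal_mul_le (p : PMF α) (x : α) {y : ℝ} (hy : |y| ≤ C) :
    |(p x).toReal * y| ≤ C := by
  rw [abs_mul, abs_of_nonneg ENNReal.toReal_nonneg]
  exact (mul_le_of_le_one_left (abs_nonneg y) (toReal_apply_le_one p x)).trans hy

theorem expectation_const (p : PMF α) (c : ℝ) : expectation p (fun _ => c) = c := by
  rw [expectation, tsum_mul_right, (hasSum_toReal p).tsum_eq, one_mul]

theorem expectation_const_mul (p : PMF α) (c : ℝ) (g : α → ℝ) :
    expectation p (fun x => c * g x) = c * expectation p g := by
  simp only [expectation, mul_left_comm _ c, tsum_mul_left]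

theorem expectation_neg (p : PMF α) (g : α → ℝ) :
    expectation p (fun x => -g x) = -expectation p g := by
  simpa using expectation_const_mul p (-1) g

theorem expectation_sub (p : PMF α) {f g : α → ℝ} (hf : ∀ x, |f x| ≤ C) (hg : ∀ x, |g x| ≤ C') :
    expectation p (fun x => f x - g x) = expectation p f - expectation p g := by
  simp only [expectation, mul_sub]
  exact (summable_toReal_mul p hf).tsum_sub (summable_toReal_mul p hg)

theorem expectation_mono (p : PMF α) {f g : α → ℝ} (hf : ∀ x, |f x| ≤ C) (hg : ∀ x, |g x| ≤ C')
    (hfg : ∀ x, f x ≤ g x) : expectation p f ≤ expectation p g :=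
  (summable_toReal_mul p hf).tsum_le_tsum
    (fun x => mul_le_mul_of_nonneg_left (hfg x) ENNReal.toReal_nonneg) (summable_toReal_mul p hg)

theorem expectation_nonneg (p : PMF α) {g : α → ℝ} (hg : ∀ x, 0 ≤ g x) : 0 ≤ expectation p g :=
  tsum_nonneg fun x => mul_nonneg ENNReal.toReal_nonneg (hg x)

theorem abs_expectation_le (p : PMF α) {g : α → ℝ} (hg : ∀ x, |g x| ≤ C) :
    |expectation p g| ≤ C := by
  have hsum := (hasSum_toReal p).mul_right C
  rw [one_mul] at hsum
  refine tsum_of_norm_bounded (f := fun x => (p x).toReal * g x) hsum fun x => ?_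
  rw [norm_mul, Real.norm_eq_abs, Real.norm_eq_abs, abs_of_nonneg ENNReal.toReal_nonneg]
  exact mul_le_mul_of_nonneg_left (hg x) ENNReal.toReal_nonneg

theorem expectation_pure (a : α) (g : α → ℝ) : expectation (PMF.pure a) g = g a := by
  rw [expectation, tsum_eq_single a fun b hb => by simp [PMF.pure_apply, hb]]
  simp

theorem toReal_bind_apply (p : PMF α) (f : α → PMF β) (y : β) :
    (p.bind f y).toReal = expectation p fun x => (f x y).toReal := by
  rw [PMF.bind_apply, ENNReal.tsum_toReal_eq]
  · simp only [ENNReal.toReal_mul, expectation]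
  · exact fun x => ENNReal.mul_ne_top (p.apply_ne_top x) ((f x).apply_ne_top y)

theorem summable_toReal_mul_toReal (p : PMF α) (f : α → PMF β) :
    Summable fun x : α × β => (p x.1).toReal * (f x.1 x.2).toReal := by
  simp only [← ENNReal.toReal_mul]
  refine ENNReal.summable_toReal ?_
  rw [ENNReal.tsum_prod (f := fun x y => p x * f x y)]
  simp [ENNReal.tsum_mul_left, PMF.tsum_coe]

theorem expectation_bind (p : PMF α) (f : α → PMF β) {g : β → ℝ} (hg : ∀ y, |g y| ≤ C) :
    expectation (p.bind f) g = expectation p fun x => expectation (f x) g := by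
  have hs : Summable fun x : α × β => (p x.1).toReal * (f x.1 x.2).toReal * g x.2 := by
    refine Summable.of_norm_bounded ((summable_toReal_mul_toReal p f).mul_right C) fun x => ?_
    rw [norm_mul, norm_mul]
    simp only [Real.norm_eq_abs, abs_of_nonneg ENNReal.toReal_nonneg]
    exact mul_le_mul_of_nonneg_left (hg _) (by positivity)
  simp only [expectation, toReal_bind_apply, ← tsum_mul_right, ← tsum_mul_left, ← mul_assoc]
  exact Summable.tsum_comm (f := fun x y => (p x).toReal * (f x y).toReal * g y) hs

theorem expectation_map (p : PMF α) (f : α → β) {g : β → ℝ} (hg : ∀ y, |g y| ≤ C) :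
    expectation (p.map f) g = expectation p fun x => g (f x) := by
  rw [← PMF.bind_pure_comp, expectation_bind _ _ hg]
  simp only [Function.comp_apply, expectation_pure]

theorem expectation_uniformOfFintype [Fintype α] [Nonempty α] (g : α → ℝ) :
    expectation (PMF.uniformOfFintype α) g = ∑ a, (Fintype.card α : ℝ)⁻¹ * g a := by
  simp [expectation, tsum_fintype]

theorem expectation_eq_card_mul_uniform [Fintype α] [Nonempty α] (p : PMF α) (g : α → ℝ) :
    expectation p g =
      Fintype.card α * expectation (PMF.uniformOfFintype α) fun a => (p a).toReal * g a := by
  rw [expectation_uniformOfFintype, ← Finset.mul_sum, mul_inv_cancel_left₀ (by simp), expectation,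
    tsum_fintype]

theorem expectation_le_card_mul_uniform [Fintype α] [Nonempty α] (p : PMF α)
    {g : α → ℝ} (hg : ∀ x, 0 ≤ g x) :
    expectation p g ≤ Fintype.card α * expectation (PMF.uniformOfFintype α) g := by
  rw [expectation_eq_card_mul_uniform]
  simp only [expectation_uniformOfFintype]
  gcongr with a
  exact mul_le_of_le_one_left (hg a) (toReal_apply_le_one p a)

theorem toOuterMeasure_le_ofReal_expectation (p : PMF α) {s : Set α} {g : α → ℝ}
    (hg : ∀ x, |g x| ≤ C) (h0 : ∀ x, 0 ≤ g x) (h1 : ∀ x ∈ s, 1 ≤ g x) :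
    p.toOuterMeasure s ≤ ENNReal.ofReal (expectation p g) := by
  rw [PMF.toOuterMeasure_apply, expectation, ENNReal.ofReal_tsum_of_nonneg
    (fun x => mul_nonneg ENNReal.toReal_nonneg (h0 x)) (summable_toReal_mul p hg)]
  refine ENNReal.tsum_le_tsum fun x => ?_
  rw [ENNReal.ofReal_mul ENNReal.toReal_nonneg, ENNReal.ofReal_toReal (p.apply_ne_top x)]
  by_cases hx : x ∈ s
  · rw [Set.indicator_of_mem hx]
    exact le_mul_of_one_le_right zero_le (ENNReal.one_le_ofReal.2 (h1 x hx))
  · simp [hx]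

end Expectation

section Hoeffding

variable {α : Type*} {C : ℝ}

theorem abs_prod_le_pow {g : α → ℝ} (hg : ∀ x, |g x| ≤ C) {n : ℕ} (y : Fin n → α) :
    |∏ i, g (y i)| ≤ C ^ n := by
  rw [Finset.abs_prod]
  exact (Finset.prod_le_prod (fun i _ => abs_nonneg _) fun i _ => hg (y i)).trans_eq (by simp)

theorem expectation_iid_prod (p : PMF α) {g : α → ℝ} (hg : ∀ x, |g x| ≤ C) (n : ℕ) :
    expectation (iid p n) (fun y => ∏ i, g (y i)) = expectation p g ^ n := by
  induction n with
  | zero => simp [iid, expectation_pure]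
  | succ n ih =>
    have hcons : ∀ x, expectation ((iid p n).bind fun y => PMF.pure (Fin.cons x y))
        (fun y : Fin (n + 1) → α => ∏ i, g (y i)) = expectation p g ^ n * g x := fun x => by
      rw [expectation_bind _ _ (abs_prod_le_pow hg)]
      simp only [expectation_pure, Fin.prod_univ_succ, Fin.cons_zero, Fin.cons_succ,
        expectation_const_mul, ih, mul_comm]
    rw [iid, expectation_bind _ _ (abs_prod_le_pow hg)]
    simp only [hcons, expectation_const_mul, pow_succ]

theorem expectation_exp_mul_sub_le (p : PMF α) {X : α → ℝ} (hX : ∀ x, |X x| ≤ C) (t : ℝ) :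
    expectation p (fun x => Real.exp (t * (X x - expectation p X))) ≤
      Real.exp (C ^ 2 * t ^ 2 / 2) := by
  let _ : MeasurableSpace α := ⊤
  have hmem : ∀ᵐ x ∂p.toMeasure, X x ∈ Set.Icc (-C) C :=
    Filter.Eventually.of_forall fun x => abs_le.1 (hX x)
  have hmeas : AEMeasurable X p.toMeasure := measurable_from_top.aemeasurable
  have hmean : ∫ x, X x ∂p.toMeasure = expectation p X :=
    PMF.integral_eq_tsum _ _ (.of_mem_Icc (-C) C hmeas hmem)
  have hsub := ProbabilityTheory.hasSubgaussianMGF_of_mem_Icc hmeas hmem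
  have hint := hsub.integrable_exp_mul t
  have hmgf := hsub.mgf_le t
  rw [ProbabilityTheory.mgf, PMF.integral_eq_tsum _ _ hint, hmean] at hmgf
  have hvar : (((‖C - -C‖₊ / 2) ^ 2 : NNReal) : ℝ) = C ^ 2 := by
    push_cast
    rw [Real.norm_eq_abs, div_pow, sq_abs]
    ring
  rwa [hvar] at hmgf

theorem expectation_exp_deviation_le (p : PMF α) {X : α → ℝ} (hC : 0 < C) (hX : ∀ x, |X x| ≤ C)
    (φ : ℝ) :
    expectation p (fun x => Real.exp (φ / C ^ 2 * (X x - expectation p X - φ))) ≤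
      Real.exp (-(φ ^ 2 / (2 * C ^ 2))) := by
  set t := φ / C ^ 2 with ht
  calc expectation p (fun x => Real.exp (t * (X x - expectation p X - φ)))
      = Real.exp (-(t * φ)) * expectation p fun x => Real.exp (t * (X x - expectation p X)) := by
        simp only [← expectation_const_mul, ← Real.exp_add]
        congr! 3
        ring
    _ ≤ Real.exp (-(t * φ)) * Real.exp (C ^ 2 * t ^ 2 / 2) := by
        gcongr
        exact expectation_exp_mul_sub_le p hX t
    _ = Real.exp (-(φ ^ 2 / (2 * C ^ 2))) := by
        rw [← Real.exp_add, ht]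
        congr 1
        field_simp
        ring

theorem toOuterMeasure_iid_lt_sum_sub_expectation_le (p : PMF α) {X : α → ℝ} (hC : 0 < C)
    (hX : ∀ x, |X x| ≤ C) (n : ℕ) {φ : ℝ} (hφ : 0 ≤ φ) :
    (iid p n).toOuterMeasure {y | n * φ < ∑ i, (X (y i) - expectation p X)} ≤
      ENNReal.ofReal (Real.exp (-(n * φ ^ 2 / (2 * C ^ 2)))) := by
  set t := φ / C ^ 2
  have ht0 : 0 ≤ t := by positivity
  set g : α → ℝ := fun x => Real.exp (t * (X x - expectation p X - φ)) with hg
  have hgC : ∀ x, |g x| ≤ Real.exp (t * (C + C - φ)) := fun x => by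
    have hXx := (abs_le.1 (hX x)).2
    have hEX := (abs_le.1 (abs_expectation_le p hX)).1
    rw [Real.abs_exp, Real.exp_le_exp]
    exact mul_le_mul_of_nonneg_left (by linarith) ht0
  have hprod : ∀ y : Fin n → α,
      ∏ i, g (y i) = Real.exp (t * (∑ i, (X (y i) - expectation p X) - n * φ)) := fun y => by
    simp [hg, ← Real.exp_sum, ← Finset.mul_sum]
  have hmean : expectation p g ≤ Real.exp (-(φ ^ 2 / (2 * C ^ 2))) :=
    expectation_exp_deviation_le p hC hX φ
  calc (iid p n).toOuterMeasure {y | n * φ < ∑ i, (X (y i) - expectation p X)}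
      ≤ ENNReal.ofReal (expectation (iid p n) fun y => ∏ i, g (y i)) := by
        refine toOuterMeasure_le_ofReal_expectation _ (abs_prod_le_pow hgC)
          (fun y => Finset.prod_nonneg fun i _ => (Real.exp_pos _).le) fun y hy => ?_
        rw [hprod, Real.one_le_exp_iff]
        exact mul_nonneg ht0 (sub_nonneg.2 (le_of_lt hy))
    _ = ENNReal.ofReal (expectation p g ^ n) := by rw [expectation_iid_prod p hgC]
    _ ≤ ENNReal.ofReal (Real.exp (-(φ ^ 2 / (2 * C ^ 2))) ^ n) := by
        gcongr
        exact expectation_nonneg p fun x => (Real.exp_pos _).le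
    _ = ENNReal.ofReal (Real.exp (-(n * φ ^ 2 / (2 * C ^ 2)))) := by
        rw [← Real.exp_nat_mul]
        congr 2
        ring

end Hoeffding

section TVDist

variable {α β : Type*}

theorem summable_abs_toReal_sub (p q : PMF α) :
    Summable fun x => |(p x).toReal - (q x).toReal| :=
  ((hasSum_toReal p).summable.sub (hasSum_toReal q).summable).abs

theorem expectation_sub_expectation (p q : PMF α) {f : α → ℝ} {C : ℝ} (hf : ∀ x, |f x| ≤ C) :
    expectation p f - expectation q f = ∑' x, ((p x).toReal - (q x).toReal) * f x := by
  simp only [sub_mul]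
  exact ((summable_toReal_mul p hf).tsum_sub (summable_toReal_mul q hf)).symm

theorem expectation_sub_expectation_le_tvDist (p q : PMF α) {f : α → ℝ} (hf : ∀ x, |f x| ≤ 1) :
    expectation p f - expectation q f ≤ tvDist p q := by
  rw [expectation_sub_expectation p q hf]
  have hle : ∀ x, ‖((p x).toReal - (q x).toReal) * f x‖ ≤ |(p x).toReal - (q x).toReal| :=
    fun x => (norm_mul _ _).trans_le (mul_le_of_le_one_right (norm_nonneg _) (hf x))
  exact (Real.le_norm_self _).trans
    (tsum_of_norm_bounded (summable_abs_toReal_sub p q).hasSum hle)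

theorem exists_expectation_sub_expectation_eq_tvDist (p q : PMF α) :
    ∃ f : α → ℝ, (∀ x, |f x| ≤ 1) ∧ expectation p f - expectation q f = tvDist p q := by
  let f : α → ℝ := fun x => SignType.sign ((p x).toReal - (q x).toReal)
  have hsign : ∀ s : SignType, |(s : ℝ)| ≤ 1 := by rintro (_ | _ | _) <;> simp
  have hf : ∀ x, |f x| ≤ 1 := fun x => hsign _
  exact ⟨f, hf, by simp only [expectation_sub_expectation p q hf, f, self_mul_sign, tvDist]⟩

theorem tvDist_nonneg (p q : PMF α) : 0 ≤ tvDist p q :=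
  tsum_nonneg fun _ => abs_nonneg _

theorem tvDist_self (p : PMF α) : tvDist p p = 0 := by
  simp [tvDist]

theorem tvDist_le_two (p q : PMF α) : tvDist p q ≤ 2 := by
  obtain ⟨f, hf, h⟩ := exists_expectation_sub_expectation_eq_tvDist p q
  linarith [abs_le.1 (abs_expectation_le p hf), abs_le.1 (abs_expectation_le q hf)]

theorem abs_tvDist_le_two (p q : PMF α) : |tvDist p q| ≤ 2 := by
  rw [abs_of_nonneg (tvDist_nonneg p q)]
  exact tvDist_le_two p q

theorem tvDist_comm (p q : PMF α) : tvDist p q = tvDist q p := by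
  simp only [tvDist, abs_sub_comm]

theorem tvDist_triangle (p q r : PMF α) : tvDist p r ≤ tvDist p q + tvDist q r := by
  obtain ⟨f, hf, h⟩ := exists_expectation_sub_expectation_eq_tvDist p r
  linarith [expectation_sub_expectation_le_tvDist p q hf,
    expectation_sub_expectation_le_tvDist q r hf]

theorem tvDist_bind_le (p q : PMF α) (f g : α → PMF β) :
    tvDist (p.bind f) (q.bind g) ≤ tvDist p q + expectation q fun x => tvDist (f x) (g x) := by
  obtain ⟨F, hF, h⟩ := exists_expectation_sub_expectation_eq_tvDist (p.bind f) (q.bind g)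
  have hfF : ∀ x, |expectation (f x) F| ≤ 1 := fun x => abs_expectation_le _ hF
  have hgF : ∀ x, |expectation (g x) F| ≤ 1 := fun x => abs_expectation_le _ hF
  have hpq := expectation_sub_expectation_le_tvDist p q hfF
  have hfg : expectation q (fun x => expectation (f x) F - expectation (g x) F) ≤
      expectation q fun x => tvDist (f x) (g x) :=
    expectation_mono q (C := 2) (C' := 2)
      (fun x => (abs_sub _ _).trans (by linarith [hfF x, hgF x]))
      (fun x => abs_tvDist_le_two _ _)
      fun x => expectation_sub_expectation_le_tvDist _ _ hF
  rw [expectation_sub q hfF hgF] at hfg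
  rw [expectation_bind _ _ hF, expectation_bind _ _ hF] at h
  linarith

theorem tvDist_bind_right_le (p : PMF α) (f g : α → PMF β) :
    tvDist (p.bind f) (p.bind g) ≤ expectation p fun x => tvDist (f x) (g x) := by
  simpa only [tvDist_self, zero_add] using tvDist_bind_le p p f g

theorem tvDist_map_le (p q : PMF α) (f : α → β) : tvDist (p.map f) (q.map f) ≤ tvDist p q := by
  obtain ⟨F, hF, h⟩ := exists_expectation_sub_expectation_eq_tvDist (p.map f) (q.map f)
  rw [← h, expectation_map p f hF, expectation_map q f hF]
  exact expectation_sub_expectation_le_tvDist p q fun x => hF (f x)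

theorem abs_expectation_sub_expectation_le_half_tvDist (p q : PMF α) {f : α → ℝ}
    (h0 : ∀ x, 0 ≤ f x) (h1 : ∀ x, f x ≤ 1) :
    |expectation p f - expectation q f| ≤ tvDist p q / 2 := by
  have hf : ∀ x, |2 * f x| ≤ 2 := fun x => abs_le.2 ⟨by linarith [h0 x], by linarith [h1 x]⟩
  have hone : ∀ _ : α, |(1 : ℝ)| ≤ 1 := fun _ => abs_one.le
  have hcentered : ∀ x, |2 * f x - 1| ≤ 1 := fun x =>
    abs_le.2 ⟨by linarith [h0 x], by linarith [h1 x]⟩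
  have hcenter : ∀ r : PMF α, expectation r (fun x => 2 * f x - 1) = 2 * expectation r f - 1 :=
    fun r => by rw [expectation_sub r hf hone, expectation_const_mul, expectation_const]
  have hpq := expectation_sub_expectation_le_tvDist p q hcentered
  have hqp := expectation_sub_expectation_le_tvDist q p hcentered
  rw [hcenter, hcenter] at hpq hqp
  rw [tvDist_comm] at hqp
  exact abs_le.2 ⟨by linarith, by linarith⟩

end TVDist

section Misfit

variable {S : Type*} {A : Type*} [Fintype A]

theorem sum_disagreement_le_vExplore (E : Env S A) (H : ℕ) (π : Policy S A)
    {N : Finset (Model S A)} {M M' : Model S A} (hM : M ∈ N) (hM' : M' ∈ N) :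
    ∑ h ∈ Finset.range H, disagreement E π M M' h ≤ vExplore E H π N :=
  le_ciSup (f := fun p : N × N => ∑ h ∈ Finset.range H, disagreement E π p.1.1 p.2.1 h)
    (Set.finite_range _).bddAbove (⟨M, hM⟩, ⟨M', hM'⟩)

theorem misfit_nonneg (E : Env S A) (π : Policy S A) (M : Model S A) (h : ℕ) :
    0 ≤ misfit E π M h :=
  expectation_nonneg (stateDist E E.Mstar π h) fun _ => Finset.sum_nonneg fun _ _ =>
    mul_nonneg (by positivity) (tvDist_nonneg _ _)

variable [Nonempty A]

/-- The law that the model `M` predicts for a sample of step `h`: roll in with `π` in `M`, take a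
uniformly random action, and observe the next state. For the true model this is `sampleLaw`. -/
noncomputable def modelSampleLaw (E : Env S A) (M : Model S A) (π : Policy S A) (h : ℕ) :
    PMF (S × A × S) :=
  (stateDist E M π h).bind fun s =>
    (PMF.uniformOfFintype A).bind fun a => (M s a).map fun s' => (s, a, s')

theorem modelSampleLaw_apply (E : Env S A) (M : Model S A) (π : Policy S A) (h : ℕ) (s : S) (a : A)
    (s' : S) :
    modelSampleLaw E M π h (s, a, s') = stateDist E M π h s * ((Fintype.card A : ENNReal)⁻¹ *
      M s a s') := by
  rw [modelSampleLaw, PMF.bind_apply, tsum_eq_single s, PMF.bind_apply, tsum_eq_single a,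
    PMF.map_apply, tsum_eq_single s']
  · simp
  all_goals intro b hb; simp [hb.symm]

theorem disagreement_eq_tvDist (E : Env S A) (π : Policy S A) (M M' : Model S A) (h : ℕ) :
    disagreement E π M M' h = tvDist (modelSampleLaw E M π h) (modelSampleLaw E M' π h) := by
  have hsum := summable_abs_toReal_sub (modelSampleLaw E M π h) (modelSampleLaw E M' π h)
  rw [tvDist, hsum.tsum_prod]
  refine tsum_congr fun s => ?_
  rw [(hsum.prod_factor s).tsum_prod, tsum_fintype]
  refine Finset.sum_congr rfl fun a _ => tsum_congr fun s' => ?_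
  simp only [modelSampleLaw_apply, ENNReal.toReal_mul, ENNReal.toReal_inv, ENNReal.toReal_natCast]
  congr 1
  ring

theorem disagreement_le_add (E : Env S A) (π : Policy S A) (M M' M'' : Model S A) (h : ℕ) :
    disagreement E π M M' h ≤ disagreement E π M M'' h + disagreement E π M' M'' h := by
  simp only [disagreement_eq_tvDist]
  rw [tvDist_comm (modelSampleLaw E M' π h)]
  exact tvDist_triangle _ _ _

theorem misfit_eq_expectation (E : Env S A) (π : Policy S A) (M : Model S A) (h : ℕ) :
    misfit E π M h = expectation (stateDist E E.Mstar π h) fun s =>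
      expectation (PMF.uniformOfFintype A) fun a => tvDist (M s a) (E.Mstar s a) := by
  simp only [expectation_uniformOfFintype]
  rfl

theorem disagreement_Mstar_le (E : Env S A) (π : Policy S A) (M : Model S A) (h : ℕ) :
    disagreement E π M E.Mstar h ≤
      tvDist (stateDist E M π h) (stateDist E E.Mstar π h) + misfit E π M h := by
  rw [disagreement_eq_tvDist, misfit_eq_expectation]
  refine (tvDist_bind_le _ _ _ _).trans (add_le_add_right (expectation_mono _ (C := 2) (C' := 2)
    (fun s => abs_tvDist_le_two _ _)
    (fun s => abs_expectation_le _ fun a => abs_tvDist_le_two _ _) fun s => ?_) _)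
  exact (tvDist_bind_right_le _ _ _).trans (expectation_mono _ (fun a => abs_tvDist_le_two _ _)
    (fun a => abs_tvDist_le_two _ _) fun a => tvDist_map_le _ _ _)

/-- Importance weighting: an action drawn from the policy is a uniform action with weight
`|𝒜| π(a | s)`. -/
theorem expectation_stateDist_succ (E : Env S A) (M : Model S A) (π : Policy S A) (h : ℕ)
    {f : S → ℝ} {C : ℝ} (hf : ∀ s, |f s| ≤ C) :
    expectation (stateDist E M π (h + 1)) f = Fintype.card A *
      expectation (modelSampleLaw E M π h) fun x => (π h x.1 x.2.1).toReal * f x.2.2 := by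
  have hw : ∀ x : S × A × S, |(π h x.1 x.2.1).toReal * f x.2.2| ≤ C := fun x =>
    abs_toReal_mul_le _ _ (hf _)
  simp only [stateDist, modelSampleLaw, expectation_bind _ _ hf, expectation_bind _ _ hw,
    expectation_map _ _ hw, expectation_const_mul]
  rw [← expectation_const_mul]
  simp only [expectation_eq_card_mul_uniform (π h _)]

theorem tvDist_stateDist_succ_le_disagreement (E : Env S A) (π : Policy S A) (M M' : Model S A)
    (h : ℕ) : tvDist (stateDist E M π (h + 1)) (stateDist E M' π (h + 1)) ≤
      Fintype.card A * disagreement E π M M' h := by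
  obtain ⟨f, hf, hfeq⟩ := exists_expectation_sub_expectation_eq_tvDist
    (stateDist E M π (h + 1)) (stateDist E M' π (h + 1))
  rw [← hfeq, expectation_stateDist_succ E M π h hf, expectation_stateDist_succ E M' π h hf,
    ← mul_sub, disagreement_eq_tvDist]
  exact mul_le_mul_of_nonneg_left (expectation_sub_expectation_le_tvDist _ _
    fun x => abs_toReal_mul_le _ _ (hf _)) (Nat.cast_nonneg _)

theorem tvDist_stateDist_succ_le_add_misfit (E : Env S A) (π : Policy S A) (M : Model S A)
    (h : ℕ) : tvDist (stateDist E M π (h + 1)) (stateDist E E.Mstar π (h + 1)) ≤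
      tvDist (stateDist E M π h) (stateDist E E.Mstar π h) + Fintype.card A * misfit E π M h := by
  rw [misfit_eq_expectation, ← expectation_const_mul]
  refine (tvDist_bind_le _ _ _ _).trans (add_le_add_right (expectation_mono _ (C := 2)
    (C' := Fintype.card A * 2) (fun s => abs_tvDist_le_two _ _) (fun s => ?_) fun s => ?_) _)
  · rw [abs_mul, Nat.abs_cast]
    exact mul_le_mul_of_nonneg_left (abs_expectation_le _ fun a => abs_tvDist_le_two _ _)
      (Nat.cast_nonneg _)
  · exact (tvDist_bind_right_le _ _ _).trans
      (expectation_le_card_mul_uniform _ fun a => tvDist_nonneg _ _)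

theorem tvDist_stateDist_le (E : Env S A) (π : Policy S A) (M : Model S A) (h : ℕ) :
    tvDist (stateDist E M π h) (stateDist E E.Mstar π h) ≤
      Fintype.card A * ∑ k ∈ Finset.range h, misfit E π M k := by
  induction h with
  | zero => simp [stateDist, tvDist_self]
  | succ h ih =>
    rw [Finset.sum_range_succ, mul_add]
    exact (tvDist_stateDist_succ_le_add_misfit E π M h).trans (by gcongr)

theorem disagreement_Mstar_le_of_misfit_le (E : Env S A) (π : Policy S A) (M : Model S A) {h : ℕ}
    {w : ℝ} (hw : ∀ k ≤ h, misfit E π M k ≤ w) :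
    disagreement E π M E.Mstar h ≤ Fintype.card A * (h + 1) * w := by
  have hA : (1 : ℝ) ≤ Fintype.card A := by exact_mod_cast Fintype.card_pos
  have hsum : ∑ k ∈ Finset.range h, misfit E π M k ≤ h * w := by
    simpa using Finset.sum_le_card_nsmul _ _ w fun k hk => hw k (Finset.mem_range.1 hk).le
  calc disagreement E π M E.Mstar h
      ≤ Fintype.card A * ∑ k ∈ Finset.range h, misfit E π M k + misfit E π M h :=
        (disagreement_Mstar_le E π M h).trans
          (add_le_add_left (tvDist_stateDist_le E π M h) _)
    _ ≤ Fintype.card A * (h * w) + Fintype.card A * w := by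
        gcongr
        exact (hw h le_rfl).trans
          (le_mul_of_one_le_left ((misfit_nonneg E π M h).trans (hw h le_rfl)) hA)
    _ = Fintype.card A * (h + 1) * w := by ring

theorem sum_disagreement_Mstar_le (E : Env S A) (H : ℕ) (π : Policy S A) (M : Model S A) {w : ℝ}
    (hw : ∀ h < H, misfit E π M h ≤ w) :
    ∑ h ∈ Finset.range H, disagreement E π M E.Mstar h ≤ Fintype.card A * (H : ℝ) ^ 2 * w := by
  have hstep : ∀ h ∈ Finset.range H,
      disagreement E π M E.Mstar h ≤ Fintype.card A * (H : ℝ) * w := fun h hh => by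
    have hhH := Finset.mem_range.1 hh
    have hw0 : 0 ≤ w := (misfit_nonneg E π M h).trans (hw h hhH)
    have hcast : (h : ℝ) + 1 ≤ H := by exact_mod_cast hhH
    refine (disagreement_Mstar_le_of_misfit_le E π M fun k hk => hw k (hk.trans_lt hhH)).trans ?_
    gcongr
  calc ∑ h ∈ Finset.range H, disagreement E π M E.Mstar h
      ≤ H * (Fintype.card A * (H : ℝ) * w) := by
        simpa using Finset.sum_le_card_nsmul _ _ _ hstep
    _ = Fintype.card A * (H : ℝ) ^ 2 * w := by ring

theorem exists_lt_misfit_of_lt_vExplore (E : Env S A) {H : ℕ} (hH : 0 < H) (π : Policy S A)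
    {N : Finset (Model S A)} (hN : N.Nonempty) {ε : ℝ}
    (hε : ε / Fintype.card A < vExplore E H π N) :
    ∃ M ∈ N, ∃ h : Fin H, ε / (2 * (H : ℝ) ^ 2 * (Fintype.card A : ℝ) ^ 2) < misfit E π M h := by
  have : Nonempty N := hN.to_subtype
  have hH' : (0 : ℝ) < H := by exact_mod_cast hH
  obtain ⟨⟨M, M'⟩, hlt⟩ := exists_lt_of_lt_ciSup hε
  dsimp only at hlt
  by_contra! hsmall
  have hhalf : ∀ K ∈ N,
      ∑ h ∈ Finset.range H, disagreement E π K E.Mstar h ≤ ε / Fintype.card A / 2 := fun K hK =>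
    (sum_disagreement_Mstar_le E H π K fun h hh => hsmall K hK ⟨h, hh⟩).trans_eq (by field_simp)
  have htri : ∑ h ∈ Finset.range H, disagreement E π M.1 M'.1 h ≤
      ∑ h ∈ Finset.range H, disagreement E π M E.Mstar h +
        ∑ h ∈ Finset.range H, disagreement E π M' E.Mstar h := by
    rw [← Finset.sum_add_distrib]
    exact Finset.sum_le_sum fun h _ => disagreement_le_add E π M M' E.Mstar h
  linarith [hhalf M M.2, hhalf M' M'.2]

theorem abs_value_sub_le (E : Env S A) (H : ℕ) (M M' : Model S A) (π : Policy S A) :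
    |value E H M π - value E H M' π| ≤
      Fintype.card A * (∑ h ∈ Finset.range H, disagreement E π M M' h) / 2 := by
  rw [value, value, ← Finset.sum_sub_distrib, Finset.mul_sum, Finset.sum_div]
  refine (Finset.abs_sum_le_sum_abs _ _).trans (Finset.sum_le_sum fun h _ => ?_)
  calc _ ≤ tvDist (stateDist E M π (h + 1)) (stateDist E M' π (h + 1)) / 2 :=
        abs_expectation_sub_expectation_le_half_tvDist _ _ E.R_nonneg E.R_le_one
    _ ≤ _ := by
        gcongr
        exact tvDist_stateDist_succ_le_disagreement E π M M' h

theorem abs_value_sub_le_of_vExplore_le (E : Env S A) {H : ℕ} {π : Policy S A}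
    {N : Finset (Model S A)} {M M' : Model S A} (hM : M ∈ N) (hM' : M' ∈ N) {ε : ℝ}
    (hε : vExplore E H π N ≤ ε / Fintype.card A) :
    |value E H M π - value E H M' π| ≤ ε / 2 := by
  have hA : (0 : ℝ) < Fintype.card A := by exact_mod_cast Fintype.card_pos
  have hsum := (sum_disagreement_le_vExplore E H π hM hM').trans hε
  refine (abs_value_sub_le E H M M' π).trans ?_
  rw [le_div_iff₀ hA, mul_comm] at hsum
  linarith

theorem value_Mstar_sub_le (E : Env S A) {H : ℕ} {Pi : Finset (Policy S A)}
    {N : Finset (Model S A)} {M : Model S A} (hM : M ∈ N) (hstar : E.Mstar ∈ N) {ε : ℝ}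
    (hε : ∀ π ∈ Pi, vExplore E H π N ≤ ε / Fintype.card A) {π π' : Policy S A} (hπ : π ∈ Pi)
    (hπ' : π' ∈ Pi) (hle : value E H M π' ≤ value E H M π) :
    value E H E.Mstar π' - ε ≤ value E H E.Mstar π := by
  have h := abs_le.1 (abs_value_sub_le_of_vExplore_le E hM hstar (hε π hπ))
  have h' := abs_le.1 (abs_value_sub_le_of_vExplore_le E hM hstar (hε π' hπ'))
  linarith

end Misfit

section Elimination

variable {S A : Type*} {H n : ℕ} {C φ : ℝ}

/-- The contribution of one sample to the empirical misfit of `M` with test function `f`. -/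
noncomputable def sampleGap (M : Model S A) (f : S × A × S → ℝ) (x : S × A × S) : ℝ :=
  expectation (M x.1 x.2.1) (fun s' => f (x.1, x.2.1, s')) - f x

theorem abs_sampleGap_le (M : Model S A) {f : S × A × S → ℝ} (hf : ∀ x, |f x| ≤ C)
    (x : S × A × S) : |sampleGap M f x| ≤ 2 * C :=
  calc |sampleGap M f x| ≤ |expectation (M x.1 x.2.1) fun s' => f (x.1, x.2.1, s')| + |f x| :=
        abs_sub _ _
    _ ≤ C + C := add_le_add (abs_expectation_le _ fun _ => hf _) (hf x)
    _ = 2 * C := (two_mul C).symm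

theorem sampleGap_neg (M : Model S A) (f : S × A × S → ℝ) (x : S × A × S) :
    sampleGap M (-f) x = -sampleGap M f x := by
  simp only [sampleGap, Pi.neg_apply, expectation_neg]
  ring

theorem inv_mul_sum_sampleGap_le_empMisfit {Ft : Set (S × A × S → ℝ)}
    (hFt : ∀ f ∈ Ft, ∀ x, |f x| ≤ C) (D : Dataset S A H n) (M : Model S A) (h : Fin H)
    {f : S × A × S → ℝ} (hf : f ∈ Ft) :
    (n : ℝ)⁻¹ * ∑ i, sampleGap M f (D i h) ≤ empMisfit Ft D M h := by
  refine le_csSup ⟨(n : ℝ)⁻¹ * (n * (2 * C)), ?_⟩ ⟨f, hf, rfl⟩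
  rintro _ ⟨g, hg, rfl⟩
  have hsum : ∑ i, sampleGap M g (D i h) ≤ n * (2 * C) := by
    simpa using Finset.sum_le_card_nsmul Finset.univ (fun i => sampleGap M g (D i h)) _
      fun i _ => (abs_le.1 (abs_sampleGap_le M (hFt g hg) _)).2
  exact mul_le_mul_of_nonneg_left hsum (by positivity)

theorem updateModelSet_subset (Ft : Set (S × A × S → ℝ)) (φ : ℝ) (N : Finset (Model S A))
    (D : Dataset S A H n) : updateModelSet Ft φ N D ⊆ N := by
  classical
  exact Finset.filter_subset _ _

theorem testSet_eq_union_range (Pi : Finset (Policy S A)) (Ms : Finset (Model S A))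
    (F : Policy S A → Model S A → Fin H → S × A × S → ℝ) :
    testSet Pi Ms F = Set.range (fun j : Pi × Ms × Fin H => F j.1 j.2.1 j.2.2) ∪
      Set.range fun j : Pi × Ms × Fin H => -F j.1 j.2.1 j.2.2 := by
  ext f
  simp only [testSet, Set.mem_ofPred_eq, Set.mem_union, Set.mem_range, Prod.exists,
    Subtype.exists, exists_prop, ← exists_or, ← and_or_left, eq_comm]

theorem finite_testSet (Pi : Finset (Policy S A)) (Ms : Finset (Model S A))
    (F : Policy S A → Model S A → Fin H → S × A × S → ℝ) : (testSet Pi Ms F).Finite := by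
  rw [testSet_eq_union_range]
  exact (Set.finite_range _).union (Set.finite_range _)

theorem ncard_testSet_le (Pi : Finset (Policy S A)) (Ms : Finset (Model S A))
    (F : Policy S A → Model S A → Fin H → S × A × S → ℝ) :
    (testSet Pi Ms F).ncard ≤ 2 * (Pi.card * (Ms.card * H)) := by
  have hrange : ∀ g : Pi × Ms × Fin H → S × A × S → ℝ,
      (Set.range g).ncard ≤ Pi.card * (Ms.card * H) := fun g => by
    rw [← Set.image_univ]
    exact (Set.ncard_image_le Set.finite_univ).trans_eq (by simp [Set.ncard_univ])
  rw [testSet_eq_union_range, two_mul]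
  exact (Set.ncard_union_le _ _).trans (add_le_add (hrange _) (hrange _))

variable [Fintype A]

theorem IsTestFamily.abs_le_one {E : Env S A} {Pi : Finset (Policy S A)} {Ms : Finset (Model S A)}
    {F : Policy S A → Model S A → Fin H → S × A × S → ℝ} (hF : IsTestFamily E H Pi Ms F) :
    ∀ f ∈ testSet Pi Ms F, ∀ x, |f x| ≤ 1 := by
  rintro _ ⟨π, hπ, M, hM, h, rfl | rfl⟩ x
  · exact (hF π hπ M hM h).1 x
  · simpa using (hF π hπ M hM h).1 x

theorem testGap_Mstar (E : Env S A) (π : Policy S A) (h : ℕ) (f : S × A × S → ℝ) :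
    testGap E π E.Mstar h f = 0 := by
  simp [testGap]

theorem testGap_neg (E : Env S A) (π : Policy S A) (M : Model S A) (h : ℕ) (f : S × A × S → ℝ) :
    testGap E π M h (-f) = -testGap E π M h f := by
  simp only [testGap, Pi.neg_apply, mul_neg, tsum_neg, ← neg_sub', Finset.sum_neg_distrib]

theorem exists_testGap_eq_misfit (E : Env S A) (π : Policy S A) (M : Model S A) (h : ℕ) :
    ∃ f : S × A × S → ℝ, (∀ x, |f x| ≤ 1) ∧ testGap E π M h f = misfit E π M h := by
  choose f hf hfeq using fun s a =>
    exists_expectation_sub_expectation_eq_tvDist (M s a) (E.Mstar s a)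
  refine ⟨fun x => f x.1 x.2.1 x.2.2, fun x => hf _ _ _, ?_⟩
  simp only [misfit, ← hfeq]
  rfl

theorem IsTestFamily.misfit_le_testGap {E : Env S A} {Pi : Finset (Policy S A)}
    {Ms : Finset (Model S A)} {F : Policy S A → Model S A → Fin H → S × A × S → ℝ}
    (hF : IsTestFamily E H Pi Ms F) {π : Policy S A} (hπ : π ∈ Pi) {M : Model S A} (hM : M ∈ Ms)
    (h : Fin H) : misfit E π M h ≤ testGap E π M h (F π M h) := by
  obtain ⟨f, hf, hfeq⟩ := exists_testGap_eq_misfit E π M h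
  exact hfeq ▸ (hF π hπ M hM h).2 f hf

/-- A data set collected with `π` is accurate if every empirical average that defines an empirical
misfit of a model in `Ms` exceeds its mean by at most `φ`. The inequality is multiplied by `n`, so
that an empty data set is accurate. -/
def IsAccurate (E : Env S A) (Ms : Finset (Model S A)) (Ft : Set (S × A × S → ℝ)) (φ : ℝ)
    (π : Policy S A) (D : Dataset S A H n) : Prop :=
  ∀ M ∈ Ms, ∀ h : Fin H, ∀ f ∈ Ft, ∑ i, (sampleGap M f (D i h) - testGap E π M h f) ≤ n * φ

section

variable {E : Env S A} {Ms N : Finset (Model S A)} {Ft : Set (S × A × S → ℝ)} {π : Policy S A}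
  {D : Dataset S A H n}

theorem IsAccurate.inv_mul_sum_sampleGap_le (hD : IsAccurate E Ms Ft φ π D) (hn : 0 < n)
    {M : Model S A} (hM : M ∈ Ms) (h : Fin H) {f : S × A × S → ℝ} (hf : f ∈ Ft) :
    (n : ℝ)⁻¹ * ∑ i, sampleGap M f (D i h) ≤ testGap E π M h f + φ := by
  have hle := hD M hM h f hf
  rw [Finset.sum_sub_distrib, Finset.sum_const, Finset.card_univ, Fintype.card_fin,
    nsmul_eq_mul] at hle
  rw [inv_mul_le_iff₀ (Nat.cast_pos.2 hn)]
  linarith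

theorem IsAccurate.Mstar_mem_updateModelSet (hD : IsAccurate E Ms Ft φ π D) (hφ : 0 ≤ φ)
    (hn : 0 < n) (hMs : E.Mstar ∈ Ms) (hN : E.Mstar ∈ N) :
    E.Mstar ∈ updateModelSet Ft φ N D := by
  classical
  refine Finset.mem_filter.2 ⟨hN, fun h => Real.sSup_le ?_ hφ⟩
  rintro _ ⟨f, hf, rfl⟩
  have hle := hD.inv_mul_sum_sampleGap_le hn hMs h hf
  rwa [testGap_Mstar, zero_add] at hle

theorem IsAccurate.testGap_le_empMisfit_add (hD : IsAccurate E Ms Ft φ π D) (hn : 0 < n)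
    (hFt : ∀ f ∈ Ft, ∀ x, |f x| ≤ C) {M : Model S A} (hM : M ∈ Ms) (h : Fin H)
    {f : S × A × S → ℝ} (hf : f ∈ Ft) (hf' : -f ∈ Ft) :
    testGap E π M h f ≤ empMisfit Ft D M h + φ := by
  have hemp := inv_mul_sum_sampleGap_le_empMisfit hFt D M h hf
  have hneg := hD.inv_mul_sum_sampleGap_le hn hM h hf'
  simp only [sampleGap_neg, Finset.sum_neg_distrib, mul_neg, testGap_neg] at hneg
  linarith

theorem IsAccurate.misfit_le_of_mem_updateModelSet {Pi : Finset (Policy S A)}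
    {F : Policy S A → Model S A → Fin H → S × A × S → ℝ}
    (hD : IsAccurate E Ms (testSet Pi Ms F) φ π D) (hF : IsTestFamily E H Pi Ms F) (hn : 0 < n)
    (hπ : π ∈ Pi) (hN : N ⊆ Ms) {M : Model S A}
    (hM : M ∈ updateModelSet (testSet Pi Ms F) φ N D) (h : Fin H) : misfit E π M h ≤ 2 * φ := by
  classical
  obtain ⟨hMN, hemp⟩ := Finset.mem_filter.1 hM
  have hMMs := hN hMN
  have hgap := hD.testGap_le_empMisfit_add hn hF.abs_le_one hMMs h
    ⟨π, hπ, M, hMMs, h, Or.inl rfl⟩ ⟨π, hπ, M, hMMs, h, Or.inr rfl⟩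
  linarith [hF.misfit_le_testGap hπ hMMs h, hemp h]

end

section

variable [Nonempty A]

theorem expectation_sampleLaw_sampleGap (E : Env S A) (π : Policy S A) (M : Model S A) (h : ℕ)
    {f : S × A × S → ℝ} (hf : ∀ x, |f x| ≤ C) :
    expectation (sampleLaw E π h) (sampleGap M f) = testGap E π M h f := by
  have hgap := abs_sampleGap_le M hf
  have hsub : ∀ s a, expectation (E.Mstar s a) (fun s' => sampleGap M f (s, a, s')) =
      expectation (M s a) (fun s' => f (s, a, s')) -
        expectation (E.Mstar s a) fun s' => f (s, a, s') := fun s a => by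
    have hconst : ∀ _ : S, |expectation (M s a) fun s' => f (s, a, s')| ≤ C := fun _ =>
      abs_expectation_le _ fun _ => hf _
    simp only [sampleGap, expectation_sub _ hconst fun _ => hf _, expectation_const]
  simp only [sampleLaw, expectation_bind _ _ hgap, expectation_map _ _ hgap, hsub,
    expectation_uniformOfFintype]
  rfl

theorem toOuterMeasure_lt_sum_sampleGap_sub_testGap_le {E : Env S A}
    {τ : Policy S A → PMF (Trajectory S A H)} (hτ : IsTrajectoryLaw E H τ) (π : Policy S A)
    (M : Model S A) (h : Fin H) {f : S × A × S → ℝ} (hf : ∀ x, |f x| ≤ 1) (n : ℕ) (hφ : 0 ≤ φ) :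
    (iid (τ π) n).toOuterMeasure {D | n * φ < ∑ i, (sampleGap M f (D i h) - testGap E π M h f)} ≤
      ENNReal.ofReal (Real.exp (-(n * φ ^ 2 / 8))) := by
  have hmean : expectation (τ π) (fun x => sampleGap M f (x h)) = testGap E π M h f := by
    rw [← expectation_map _ (fun x : Trajectory S A H => x h) (abs_sampleGap_le M hf), hτ π h,
      expectation_sampleLaw_sampleGap E π M h hf]
  convert toOuterMeasure_iid_lt_sum_sub_expectation_le (τ π) (X := fun x => sampleGap M f (x h))
    (C := 2) two_pos (fun x => (abs_sampleGap_le M hf _).trans_eq (mul_one 2)) n hφ using 5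
  · rw [hmean]
  · norm_num

theorem toOuterMeasure_not_isAccurate_le {E : Env S A} (Ms : Finset (Model S A))
    {Ft : Set (S × A × S → ℝ)} (hFt : ∀ f ∈ Ft, ∀ x, |f x| ≤ 1) (hfin : Ft.Finite)
    {τ : Policy S A → PMF (Trajectory S A H)} (hτ : IsTrajectoryLaw E H τ) (π : Policy S A)
    (n : ℕ) (hφ : 0 ≤ φ) :
    (iid (τ π) n).toOuterMeasure {D | ¬ IsAccurate E Ms Ft φ π D} ≤
      ENNReal.ofReal (Ms.card * (H * Ft.ncard) * Real.exp (-(n * φ ^ 2 / 8))) := by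
  let I : Finset (Model S A × Fin H × (S × A × S → ℝ)) := Ms ×ˢ Finset.univ ×ˢ hfin.toFinset
  have hunion : {D : Dataset S A H n | ¬ IsAccurate E Ms Ft φ π D} ⊆ ⋃ j ∈ I, {D |
      n * φ < ∑ i, (sampleGap j.1 j.2.2 (D i j.2.1) - testGap E π j.1 j.2.1 j.2.2)} := by
    intro D hD
    simp only [IsAccurate, Set.mem_ofPred_eq, not_forall, not_le] at hD
    obtain ⟨M, hM, h, f, hf, hlt⟩ := hD
    exact Set.mem_biUnion (x := (M, h, f)) (by simp [I, hM, hf]) hlt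
  have hI : I.card = Ms.card * (H * Ft.ncard) := by
    simp [I, Finset.card_product, Set.ncard_eq_toFinset_card _ hfin]
  calc (iid (τ π) n).toOuterMeasure {D | ¬ IsAccurate E Ms Ft φ π D}
      ≤ ∑ j ∈ I, (iid (τ π) n).toOuterMeasure {D |
          n * φ < ∑ i, (sampleGap j.1 j.2.2 (D i j.2.1) - testGap E π j.1 j.2.1 j.2.2)} :=
        (MeasureTheory.measure_mono hunion).trans (MeasureTheory.measure_biUnion_finset_le _ _)
    _ ≤ I.card • ENNReal.ofReal (Real.exp (-(n * φ ^ 2 / 8))) :=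
        Finset.sum_le_card_nsmul _ _ _ fun j hj =>
          toOuterMeasure_lt_sum_sampleGap_sub_testGap_le hτ π j.1 j.2.1
            (hFt j.2.2 (hfin.mem_toFinset.1
              (Finset.mem_product.1 (Finset.mem_product.1 hj).2).2)) n hφ
    _ = ENNReal.ofReal (Ms.card * (H * Ft.ncard) * Real.exp (-(n * φ ^ 2 / 8))) := by
        rw [hI, ← ENNReal.ofReal_nsmul, nsmul_eq_mul]
        push_cast
        rfl

end

end Elimination

section History

theorem length_eq_sum_length_filter {α ι : Type*} [Fintype ι] [DecidableEq ι] (g : α → ι)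
    (l : List α) : l.length = ∑ i, (l.filter fun x => g x = i).length := by
  simp only [← List.countP_eq_length_filter]
  induction l with
  | nil => simp
  | cons a l ih =>
    simp only [List.countP_cons, Finset.sum_add_distrib, ← ih, List.length_cons]
    simp

variable {S A : Type*} [Fintype A] {E : Env S A} {H : ℕ} {Pi : Finset (Policy S A)}
  {Ms N : Finset (Model S A)} {η w β : ℝ} {d : ℕ} {l : List (Pi × Ms × Fin H)}

/-- The witnesses of past exploration rounds, most recent first: in each round a policy, a model
and a step with misfit above `w`, where all later witnesses and the models in `N` have misfit at
most `η` under that policy. -/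
structure IsHistory (E : Env S A) (Pi : Finset (Policy S A)) (Ms : Finset (Model S A)) (η w : ℝ)
    (N : Finset (Model S A)) (l : List (Pi × Ms × Fin H)) : Prop where
  large : ∀ x ∈ l, w < misfit E x.1 x.2.1 x.2.2
  pairwise : l.Pairwise fun x y => ∀ h : Fin H, misfit E y.1 x.2.1 h ≤ η
  small : ∀ x ∈ l, ∀ M ∈ N, ∀ h : Fin H, misfit E x.1 M h ≤ η

theorem isHistory_nil : IsHistory E Pi Ms η w N ([] : List (Pi × Ms × Fin H)) :=
  ⟨by simp, .nil, by simp⟩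

theorem IsHistory.cons (hl : IsHistory E Pi Ms η w N l) {x : Pi × Ms × Fin H}
    (hx : x.2.1.1 ∈ N) (hlarge : w < misfit E x.1 x.2.1 x.2.2) {N' : Finset (Model S A)}
    (hsub : N' ⊆ N) (hsmall : ∀ M ∈ N', ∀ h : Fin H, misfit E x.1 M h ≤ η) :
    IsHistory E Pi Ms η w N' (x :: l) where
  large := List.forall_mem_cons.2 ⟨hlarge, hl.large⟩
  pairwise := List.pairwise_cons.2 ⟨fun y hy => hl.small y hy _ hx, hl.pairwise⟩
  small := List.forall_mem_cons.2 ⟨hsmall, fun y hy M hM => hl.small y hy M (hsub hM)⟩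

theorem IsHistory.isEluderSequence (hl : IsHistory E Pi Ms η w N l) (h : Fin H) :
    IsEluderSequence (misfitMatrix E Pi Ms h) η w
      ((l.filter fun x => x.2.2 = h).map fun x => (x.1, x.2.1)) where
  large := by
    simp only [List.forall_mem_map, List.mem_filter, decide_eq_true_eq]
    rintro x ⟨hx, rfl⟩
    exact hl.large x hx
  pairwise := by
    rw [List.pairwise_map]
    refine (hl.pairwise.filter _).imp fun hxy => ?_
    rw [misfitMatrix, Matrix.of_apply, abs_of_nonneg (misfit_nonneg _ _ _ _)]
    exact hxy h

theorem IsHistory.length_mul_log_two_le (hl : IsHistory E Pi Ms η (6 * η * √d) N l) (hη : 0 < η)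
    (hηβ : η ≤ β) (hrank : ∀ h : Fin H, normRank (misfitMatrix E Pi Ms h) β ≤ d) :
    l.length * Real.log 2 ≤ H * d * Real.log (β / η) := by
  have hstep : ∀ h : Fin H, (l.filter fun x => x.2.2 = h).length * Real.log 2 ≤
      d * Real.log (β / η) := fun h => by
    simpa using (hl.isEluderSequence h).length_mul_log_two_le hη hηβ (hrank h)
  calc l.length * Real.log 2
      = ∑ h : Fin H, (l.filter fun x => x.2.2 = h).length * Real.log 2 := by
        rw [length_eq_sum_length_filter (fun x => x.2.2) l, Nat.cast_sum, Finset.sum_mul]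
    _ ≤ ∑ _h : Fin H, d * Real.log (β / η) := Finset.sum_le_sum fun h _ => hstep h
    _ = H * d * Real.log (β / η) := by simp [mul_assoc]

theorem misfit_le_of_normRank_le {π : Policy S A} (hπ : π ∈ Pi) {M : Model S A} (hM : M ∈ Ms)
    {h : ℕ} (hrank : normRank (misfitMatrix E Pi Ms h) β ≤ d) : misfit E π M h ≤ β := by
  obtain ⟨k, -, hk⟩ := exists_hasFactorization_of_normRank_le hrank
  exact hk.apply_le ⟨π, hπ⟩ ⟨M, hM⟩

theorem six_mul_le_of_lt_misfit {π : Policy S A} (hπ : π ∈ Pi) {M : Model S A} (hM : M ∈ Ms)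
    {h : ℕ} (hrank : normRank (misfitMatrix E Pi Ms h) β ≤ d) (hη : 0 ≤ η) (hd : 0 < d)
    (hlt : 6 * η * √d < misfit E π M h) : 6 * η ≤ β :=
  calc 6 * η ≤ 6 * η * √d :=
        le_mul_of_one_le_right (by positivity) (Real.one_le_sqrt.2 (Nat.one_le_cast.2 hd))
    _ ≤ β := hlt.le.trans (misfit_le_of_normRank_le hπ hM hrank)

theorem IsHistory.length_le (hl : IsHistory E Pi Ms η (6 * η * √d) N l) (hη : 0 < η) (hd : 0 < d)
    (hrank : ∀ h : Fin H, normRank (misfitMatrix E Pi Ms h) β ≤ d) {T : ℝ} (hT : 0 ≤ T)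
    (hHd : T = H * d * Real.log (β / η) / Real.log (5 / 3)) : l.length ≤ T := by
  rcases l.eq_nil_or_concat with rfl | ⟨l', x, rfl⟩
  · simpa using hT
  have hηβ : η ≤ β := by
    linarith [six_mul_le_of_lt_misfit x.1.2 x.2.1.2 (hrank _) hη.le hd (hl.large x (by simp))]
  rw [hHd, le_div_iff₀ (Real.log_pos (by norm_num))]
  refine le_trans ?_ (hl.length_mul_log_two_le hη hηβ hrank)
  gcongr
  norm_num

end History

section Run

open scoped ENNReal

theorem one_le_toOuterMeasure_add_compl {α : Type*} (p : PMF α) (s : Set α) :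
    1 ≤ p.toOuterMeasure s + p.toOuterMeasure sᶜ := by
  have huniv : p.toOuterMeasure Set.univ = 1 :=
    (p.toOuterMeasure_apply_eq_one_iff _).2 (Set.subset_univ _)
  rw [← huniv, ← Set.union_compl_self s]
  exact MeasureTheory.measure_union_le _ _

theorem toOuterMeasure_le_one {α : Type*} (p : PMF α) (s : Set α) : p.toOuterMeasure s ≤ 1 :=
  (MeasureTheory.measure_mono (Set.subset_univ s)).trans_eq
    ((p.toOuterMeasure_apply_eq_one_iff _).2 (Set.subset_univ _))

theorem toOuterMeasure_bind_compl_le {α β : Type*} (p : PMF α) (f : α → PMF β) {s : Set α}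
    {t : Set β} {r : ℝ≥0∞} (h : ∀ x ∈ s, (f x).toOuterMeasure tᶜ ≤ r) :
    (p.bind f).toOuterMeasure tᶜ ≤ p.toOuterMeasure sᶜ + r := by
  rw [PMF.toOuterMeasure_bind_apply, PMF.toOuterMeasure_apply]
  calc ∑' x, p x * (f x).toOuterMeasure tᶜ ≤ ∑' x, (sᶜ.indicator p x + p x * r) := by
        refine ENNReal.tsum_le_tsum fun x => ?_
        by_cases hx : x ∈ s
        · exact (mul_le_mul_right (h x hx) (p x)).trans le_add_self
        · rw [Set.indicator_of_mem (Set.mem_compl hx)]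
          exact (mul_le_of_le_one_right' (toOuterMeasure_le_one _ _)).trans le_self_add
    _ = ∑' x, sᶜ.indicator p x + r := by
        rw [ENNReal.tsum_add, ENNReal.tsum_mul_right, p.tsum_coe, one_mul]

theorem toOuterMeasure_pure_compl_of_mem {α : Type*} {x : α} {s : Set α} (hx : x ∈ s) :
    (PMF.pure x).toOuterMeasure sᶜ = 0 := by
  rw [PMF.toOuterMeasure_pure_apply, if_neg (by simpa using hx)]

variable {S A : Type*} [Fintype A] {E : Env S A} {H n : ℕ} {Pi : Finset (Policy S A)}
  {Ms N : Finset (Model S A)} {τ : Policy S A → PMF (Trajectory S A H)}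
  {Ft : Set (S × A × S → ℝ)} {P : Planner S A H n} {ε φ : ℝ} {r : ℝ≥0∞}

theorem haltProb_mono {G G' : Buffer S A H n → Policy S A → Prop} (h : ∀ b π, G b π → G' b π) :
    haltProb E τ Ft P ε φ Ms G ≤ haltProb E τ Ft P ε φ Ms G' :=
  iSup_mono fun _ => MeasureTheory.measure_mono fun _ ⟨b, π, hx, hG⟩ => ⟨b, π, hx, h b π hG⟩

theorem toOuterMeasure_run_compl_le {Inv : ℕ → Set (State S A H n)}
    (hzero : .running [] Ms ∈ Inv 0)
    (hstep : ∀ k, ∀ x ∈ Inv k, (step E τ Ft P ε φ x).toOuterMeasure (Inv (k + 1))ᶜ ≤ r) (k : ℕ) :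
    (run E τ Ft P ε φ Ms k).toOuterMeasure (Inv k)ᶜ ≤ k * r := by
  induction k with
  | zero =>
    rw [run, toOuterMeasure_pure_compl_of_mem hzero]
    exact zero_le
  | succ k ih =>
    rw [run, Nat.cast_succ, add_mul, one_mul]
    exact (toOuterMeasure_bind_compl_le _ _ (hstep k)).trans (by gcongr)

theorem one_sub_le_haltProb {Inv : ℕ → Set (State S A H n)} (hzero : .running [] Ms ∈ Inv 0)
    (hstep : ∀ k, ∀ x ∈ Inv k, (step E τ Ft P ε φ x).toOuterMeasure (Inv (k + 1))ᶜ ≤ r)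
    {G : Buffer S A H n → Policy S A → Prop} {K : ℕ}
    (hK : ∀ x ∈ Inv K, ∃ b π, x = .halted b π ∧ G b π) :
    1 - K * r ≤ haltProb E τ Ft P ε φ Ms G := by
  refine le_trans ?_ (le_iSup _ K)
  rw [tsub_le_iff_right]
  exact (one_le_toOuterMeasure_add_compl (run E τ Ft P ε φ Ms K) (Inv K)).trans
    (add_le_add (MeasureTheory.measure_mono hK) (toOuterMeasure_run_compl_le hzero hstep K))

/-- The state after `k` iterations is on track: either the algorithm has explored `k` times and has
kept the true model, or it has halted with a policy that is `ε`-optimal within `Pi`; in both cases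
there is one witness in a history for each data set collected. -/
inductive IsOnTrack (E : Env S A) (Pi : Finset (Policy S A)) (Ms : Finset (Model S A))
    (ε η w : ℝ) (k : ℕ) : State S A H n → Prop
  | running {b : Buffer S A H n} {N : Finset (Model S A)} {l : List (Pi × Ms × Fin H)}
      (hb : b.length = k) (hlb : l.length = b.length) (hl : IsHistory E Pi Ms η w N l)
      (hN : N ⊆ Ms) (hstar : E.Mstar ∈ N) : IsOnTrack E Pi Ms ε η w k (.running b N)
  | halted {b : Buffer S A H n} {π : Policy S A} {N : Finset (Model S A)}
      {l : List (Pi × Ms × Fin H)} (hlb : l.length = b.length) (hl : IsHistory E Pi Ms η w N l)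
      (hπ : ∀ π' ∈ Pi, value E H E.Mstar π' - ε ≤ value E H E.Mstar π) :
      IsOnTrack E Pi Ms ε η w k (.halted b π)

theorem IsOnTrack.exists_eq_halted {η w : ℝ} {k : ℕ} {T : ℝ} {x : State S A H n}
    (hx : IsOnTrack E Pi Ms ε η w k x) (hTk : T < k)
    (hT : ∀ (N : Finset (Model S A)) (l : List (Pi × Ms × Fin H)),
      IsHistory E Pi Ms η w N l → l.length ≤ T) :
    ∃ b π, x = .halted b π ∧ (∀ π' ∈ Pi, value E H E.Mstar π' - ε ≤ value E H E.Mstar π) ∧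
      b.length ≤ T := by
  rcases hx with ⟨hb, hlb, hl, -, -⟩ | ⟨hlb, hl, hπ⟩
  · have := hT _ _ hl
    rw [hlb, hb] at this
    linarith
  · exact ⟨_, _, rfl, hπ, hlb ▸ hT _ _ hl⟩

theorem value_exploit_choose_le [Nonempty A] (hP : P.IsExact E Pi Ms) (b : Buffer S A H n)
    (hN : N ⊆ Ms) (hstar : E.Mstar ∈ N)
    (hε : vExplore E H (P.explore b N) N ≤ ε / Fintype.card A) {π' : Policy S A} (hπ' : π' ∈ Pi) :
    value E H E.Mstar π' - ε ≤ value E H E.Mstar (P.exploit b (P.choose b N)) :=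
  have hne : N.Nonempty := ⟨_, hstar⟩
  have hM := hP.choose_mem b N hN hne
  value_Mstar_sub_le E hM hstar (fun π hπ => (hP.explore_max b N hN hne π hπ).trans hε)
    (hP.exploit_mem b _ (hN hM)) hπ' (hP.exploit_max b _ (hN hM) π' hπ')

theorem toOuterMeasure_step_isOnTrack_compl_le [Nonempty A] {w : ℝ} (hH : 0 < H)
    {F : Policy S A → Model S A → Fin H → S × A × S → ℝ} (hF : IsTestFamily E H Pi Ms F)
    (hP : P.IsExact E Pi Ms) (hφ : 0 ≤ φ)
    (hw : w ≤ ε / (2 * (H : ℝ) ^ 2 * (Fintype.card A : ℝ) ^ 2))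
    (hr : ∀ π ∈ Pi, ∀ M ∈ Ms, ∀ h : Fin H, w < misfit E π M h → 0 < n ∧
      (iid (τ π) n).toOuterMeasure {D | ¬ IsAccurate E Ms (testSet Pi Ms F) φ π D} ≤ r)
    (k : ℕ) (x : State S A H n) (hx : IsOnTrack E Pi Ms ε (2 * φ) w k x) :
    (step E τ (testSet Pi Ms F) P ε φ x).toOuterMeasure
      {y | IsOnTrack E Pi Ms ε (2 * φ) w (k + 1) y}ᶜ ≤ r := by
  classical
  rcases hx with ⟨hb, hlb, hl, hN, hstar⟩ | ⟨hlb, hl, hπ⟩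
  case halted =>
    rw [step, toOuterMeasure_pure_compl_of_mem (.halted hlb hl hπ)]
    exact zero_le
  case running b N l =>
    have hne : N.Nonempty := ⟨_, hstar⟩
    rw [step, if_pos hne]
    split_ifs with hexplore
    · have hπ := hP.explore_mem b N hN hne
      set π := P.explore b N
      obtain ⟨M, hM, h, hlt⟩ := exists_lt_misfit_of_lt_vExplore E hH π hne hexplore
      obtain ⟨hn, hfail⟩ := hr π hπ M (hN hM) h (hw.trans_lt hlt)
      rw [PMF.toOuterMeasure_map_apply]
      refine le_trans (MeasureTheory.measure_mono fun D hD (hacc : IsAccurate _ _ _ _ _ D) =>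
        hD ?_) hfail
      exact .running (by simp [hb]) (l := (⟨π, hπ⟩, ⟨M, hN hM⟩, h) :: l) (by simp [hlb])
        (hl.cons hM (hw.trans_lt hlt) (updateModelSet_subset _ _ _ _) fun M' hM' h' =>
          hacc.misfit_le_of_mem_updateModelSet hF hn hπ hN hM' h')
        ((updateModelSet_subset _ _ _ _).trans hN)
        (hacc.Mstar_mem_updateModelSet hφ hn (hN hstar) hstar)
    · rw [toOuterMeasure_pure_compl_of_mem (.halted hlb hl fun π' =>
        value_exploit_choose_le hP b hN hstar (not_lt.1 hexplore))]
      exact zero_le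

end Run

section Parameters

theorem threshold_pos {H a d : ℕ} {ε : ℝ} (hH : 0 < H) (ha : 0 < a) (hd : 0 < d) (hε : 0 < ε) :
    0 < threshold H a d ε := by
  unfold threshold
  positivity

theorem pos_of_roundBound_pos {H a d : ℕ} {ε β : ℝ} (hT : 0 < roundBound H a d ε β) :
    0 < H ∧ 0 < d := by
  constructor <;> refine Nat.pos_of_ne_zero fun h => ?_ <;> simp [roundBound, h] at hT

theorem six_mul_two_mul_threshold_mul_sqrt {H a d : ℕ} (ε : ℝ) (hd : 0 < d) :
    6 * (2 * threshold H a d ε) * √d = ε / (2 * (H : ℝ) ^ 2 * (a : ℝ) ^ 2) := by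
  have hsqrt : √(d : ℝ) ≠ 0 := (Real.sqrt_pos.2 (Nat.cast_pos.2 hd)).ne'
  rw [threshold]
  field_simp
  ring

theorem mul_log_le_mul_sq_threshold {H a d n : ℕ} {ε L : ℝ} (hH : 0 < H) (ha : 0 < a)
    (hd : 0 < d) (hε : 0 < ε) (hn : 18432 * ((H : ℝ) ^ 4 * (a : ℝ) ^ 4 * d * L / ε ^ 2) ≤ n) :
    32 * L ≤ n * threshold H a d ε ^ 2 := by
  have hsq : threshold H a d ε ^ 2 = ε ^ 2 / (576 * ((H : ℝ) ^ 4 * (a : ℝ) ^ 4 * d)) := by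
    rw [threshold, div_pow, mul_pow, Real.sq_sqrt (Nat.cast_nonneg d)]
    ring
  calc 32 * L = 18432 * ((H : ℝ) ^ 4 * (a : ℝ) ^ 4 * d * L / ε ^ 2) * threshold H a d ε ^ 2 := by
        rw [hsq]
        field_simp
        ring
    _ ≤ n * threshold H a d ε ^ 2 := by gcongr

theorem three_mul_le_roundBound {H a d : ℕ} {ε β : ℝ} (hd : 0 < d) (hφ : 0 < threshold H a d ε)
    (hβ : 6 * (2 * threshold H a d ε) ≤ β) : 3 * H ≤ roundBound H a d ε β := by
  have hlog53 : 0 < Real.log (5 / 3) := Real.log_pos (by norm_num)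
  have hlog : 3 * Real.log (5 / 3) ≤ Real.log (β / (2 * threshold H a d ε)) :=
    calc 3 * Real.log (5 / 3) = Real.log ((5 / 3) ^ 3) := by rw [Real.log_pow]; norm_num
      _ ≤ Real.log 6 := Real.log_le_log (by norm_num) (by norm_num)
      _ ≤ _ := Real.log_le_log (by norm_num) ((le_div_iff₀ (by positivity)).2 hβ)
  rw [roundBound, le_div_iff₀ hlog53]
  calc 3 * H * Real.log (5 / 3) = H * 1 * (3 * Real.log (5 / 3)) := by ring
    _ ≤ H * d * Real.log (β / (2 * threshold H a d ε)) := by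
      gcongr
      exact Nat.one_le_cast.2 hd

theorem mul_roundBound_le {H a d n : ℕ} {ε β C L : ℝ} (hT : 0 ≤ roundBound H a d ε β)
    (hn : n ≤ C * ((H : ℝ) ^ 4 * (a : ℝ) ^ 4 * d * L / ε ^ 2)) :
    n * roundBound H a d ε β ≤ C / Real.log (5 / 3) * ((H : ℝ) ^ 5 * (d : ℝ) ^ 2 * (a : ℝ) ^ 4 /
      ε ^ 2 * L * Real.log (β / (2 * threshold H a d ε))) :=
  calc n * roundBound H a d ε β
      ≤ C * ((H : ℝ) ^ 4 * (a : ℝ) ^ 4 * d * L / ε ^ 2) * roundBound H a d ε β := by gcongr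
    _ = _ := by
      rw [roundBound]
      ring

theorem exp_neg_le_inv_pow {y z : ℝ} {k : ℕ} (hz : 0 < z) (hy : k * Real.log z ≤ y) :
    Real.exp (-y) ≤ (z ^ k)⁻¹ := by
  rw [← Real.log_pow] at hy
  rw [Real.exp_neg]
  exact inv_anti₀ (by positivity) ((Real.log_le_iff_le_exp (by positivity)).1 hy)

theorem two_mul_sq_mul_add_one_le_pow_four {H T : ℝ} (hH : 1 ≤ H) (hT : 3 * H ≤ T) :
    2 * H ^ 2 * (T + 1) ≤ T ^ 4 := by
  have hT0 : 0 < T := by linarith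
  calc 2 * H ^ 2 * (T + 1) ≤ 2 * (T / 3) ^ 2 * (T + T) := by gcongr <;> linarith
    _ = 4 / 9 * T ^ 3 := by ring
    _ ≤ T * T ^ 3 := by gcongr; linarith
    _ = T ^ 4 := by ring

theorem card_mul_exp_neg_le {H m p T δ y : ℝ} (hH : 1 ≤ H) (hm : 1 ≤ m) (hp : 1 ≤ p)
    (hT : 3 * H ≤ T) (hδ : 0 < δ) (hδ1 : δ ≤ 1) (hy : 4 * Real.log (T * m * p / δ) ≤ y) :
    m * (H * (2 * (p * (m * H)))) * Real.exp (-y) ≤ δ / (T + 1) := by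
  have hT0 : 0 < T := by linarith
  have hexp : Real.exp (-y) ≤ ((T * m * p / δ) ^ 4)⁻¹ :=
    exp_neg_le_inv_pow (by positivity) (by exact_mod_cast hy)
  rw [le_div_iff₀ (by positivity)]
  calc m * (H * (2 * (p * (m * H)))) * Real.exp (-y) * (T + 1)
      ≤ m * (H * (2 * (p * (m * H)))) * ((T * m * p / δ) ^ 4)⁻¹ * (T + 1) := by gcongr
    _ = 2 * H ^ 2 * (T + 1) / T ^ 4 * (1 / m ^ 2) * (1 / p ^ 3) * (δ ^ 3 * δ) := by
      field_simp
    _ ≤ 1 * 1 * 1 * (1 * δ) := by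
      gcongr
      · exact div_le_one_of_le₀ (two_mul_sq_mul_add_one_le_pow_four hH hT) (by positivity)
      · exact div_le_one_of_le₀ (one_le_pow₀ hm) (by positivity)
      · exact div_le_one_of_le₀ (one_le_pow₀ hp) (by positivity)
      · exact pow_le_one₀ hδ.le hδ1
    _ = δ := by ring

theorem log_pos_of_three_mul_le {H m p T δ : ℝ} (hH : 1 ≤ H) (hm : 1 ≤ m) (hp : 1 ≤ p)
    (hT : 3 * H ≤ T) (hδ : 0 < δ) (hδ1 : δ ≤ 1) : 0 < Real.log (T * m * p / δ) := by
  have hT1 : 1 < T := by linarith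
  refine Real.log_pos ((one_lt_div hδ).2 (hδ1.trans_lt ?_))
  calc 1 < T := hT1
    _ ≤ T * (m * p) := le_mul_of_one_le_right (by positivity) (one_le_mul_of_one_le_of_one_le hm hp)
    _ = T * m * p := (mul_assoc _ _ _).symm

end Parameters

section Guarantee

variable {S A : Type*} [Fintype A] [Nonempty A] {E : Env S A} {H n d : ℕ}
  {Pi : Finset (Policy S A)} {Ms : Finset (Model S A)} {ε β δ T : ℝ}
  {τ : Policy S A → PMF (Trajectory S A H)} {F : Policy S A → Model S A → Fin H → S × A × S → ℝ}

theorem toOuterMeasure_not_isAccurate_testSet_le (hF : IsTestFamily E H Pi Ms F)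
    (hτ : IsTrajectoryLaw E H τ) (hMs : Ms.Nonempty) (hPi : Pi.Nonempty) (hH : 0 < H)
    (hT : 3 * H ≤ T) (hδ : 0 < δ) (hδ1 : δ ≤ 1) {φ : ℝ} (hφ : 0 ≤ φ)
    (hn : 32 * Real.log (T * Ms.card * Pi.card / δ) ≤ n * φ ^ 2) (π : Policy S A) :
    0 < n ∧ (iid (τ π) n).toOuterMeasure {D | ¬ IsAccurate E Ms (testSet Pi Ms F) φ π D} ≤
      ENNReal.ofReal (δ / (T + 1)) := by
  have hH1 : (1 : ℝ) ≤ H := Nat.one_le_cast.2 hH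
  have hm1 : (1 : ℝ) ≤ Ms.card := Nat.one_le_cast.2 hMs.card_pos
  have hp1 : (1 : ℝ) ≤ Pi.card := Nat.one_le_cast.2 hPi.card_pos
  have hlog := log_pos_of_three_mul_le hH1 hm1 hp1 hT hδ hδ1
  refine ⟨Nat.pos_of_ne_zero fun h => ?_, (toOuterMeasure_not_isAccurate_le Ms hF.abs_le_one
    (finite_testSet Pi Ms F) hτ π n hφ).trans (ENNReal.ofReal_le_ofReal ?_)⟩
  · rw [h, Nat.cast_zero, zero_mul] at hn
    linarith
  · refine le_trans ?_ (card_mul_exp_neg_le (y := n * φ ^ 2 / 8) hH1 hm1 hp1 hT hδ hδ1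
      (by linarith))
    gcongr
    exact_mod_cast ncard_testSet_le Pi Ms F

theorem ofReal_one_sub_le_one_sub_floor_mul (hT : 0 ≤ T) (hδ : 0 ≤ δ) :
    ENNReal.ofReal (1 - δ) ≤ 1 - (⌊T⌋₊ + 1 : ℕ) * ENNReal.ofReal (δ / (T + 1)) := by
  rw [ENNReal.ofReal_sub _ hδ, ENNReal.ofReal_one, ← ENNReal.ofReal_natCast,
    ← ENNReal.ofReal_mul (by positivity)]
  refine tsub_le_tsub_left (ENNReal.ofReal_le_ofReal ?_) _
  rw [mul_div_assoc', div_le_iff₀ (by positivity), mul_comm]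
  have := Nat.floor_le hT
  push_cast
  gcongr

end Guarantee

end DREEM

theorem theorem1_general {S A : Type*} [Fintype A] [Nonempty A] (E : DREEM.Env S A) (H : ℕ)
    (Ms : Finset (DREEM.Model S A)) (Pi : Finset (DREEM.Policy S A)) (hstar : E.Mstar ∈ Ms)
    (hPi : Pi.Nonempty) (β : ℝ) (d : ℕ)
    (hrank : ∀ h : Fin H, DREEM.normRank (DREEM.misfitMatrix E Pi Ms h) β ≤ d)
    (ε δ : ℝ) (hε : 0 < ε) (hδ : 0 < δ) (hδ1 : δ ≤ 1)
    (φ T : ℝ) (hφ : φ = DREEM.threshold H (Fintype.card A) d ε)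
    (hT : T = DREEM.roundBound H (Fintype.card A) d ε β) (hTpos : 0 < T)
    (n : ℕ)
    (hn : 18432 * ((H : ℝ) ^ 4 * (Fintype.card A : ℝ) ^ 4 * d *
      Real.log (T * Ms.card * Pi.card / δ) / ε ^ 2) ≤ n)
    (τ : DREEM.Policy S A → PMF (DREEM.Trajectory S A H)) (hτ : DREEM.IsTrajectoryLaw E H τ)
    (F : DREEM.Policy S A → DREEM.Model S A → Fin H → S × A × S → ℝ)
    (hF : DREEM.IsTestFamily E H Pi Ms F) (P : DREEM.Planner S A H n) (hP : P.IsExact E Pi Ms) :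
    ENNReal.ofReal (1 - δ) ≤ DREEM.haltProb E τ (DREEM.testSet Pi Ms F) P ε φ Ms fun b π =>
      (∀ π' ∈ Pi, DREEM.value E H E.Mstar π' - ε ≤ DREEM.value E H E.Mstar π) ∧
        b.length ≤ T := by
  obtain ⟨hH, hd⟩ := DREEM.pos_of_roundBound_pos (hT ▸ hTpos)
  have hφ0 : 0 < φ := hφ ▸ DREEM.threshold_pos hH Fintype.card_pos hd hε
  have hnφ : 32 * Real.log (T * Ms.card * Pi.card / δ) ≤ n * φ ^ 2 :=
    hφ ▸ DREEM.mul_log_le_mul_sq_threshold hH Fintype.card_pos hd hε hn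
  have hlength : ∀ N l, DREEM.IsHistory E Pi Ms (2 * φ) (6 * (2 * φ) * √d) N l → l.length ≤ T :=
    fun N l hl => hl.length_le (by positivity) hd hrank hTpos.le
      (by rw [hT, hφ, DREEM.roundBound])
  have hw : 6 * (2 * φ) * √d ≤ ε / (2 * (H : ℝ) ^ 2 * (Fintype.card A : ℝ) ^ 2) :=
    (hφ ▸ DREEM.six_mul_two_mul_threshold_mul_sqrt ε hd).le
  refine (DREEM.ofReal_one_sub_le_one_sub_floor_mul hTpos.le hδ.le).trans
    (DREEM.one_sub_le_haltProb
      (Inv := fun k => {x | DREEM.IsOnTrack E Pi Ms ε (2 * φ) (6 * (2 * φ) * √d) k x})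
      (.running rfl rfl DREEM.isHistory_nil subset_rfl hstar)
      (DREEM.toOuterMeasure_step_isOnTrack_compl_le hH hF hP hφ0.le hw ?_)
      fun x hx => hx.exists_eq_halted (by exact_mod_cast Nat.lt_floor_add_one T) hlength)
  intro π hπ M hM h hlt
  have hβ : 6 * (2 * φ) ≤ β :=
    DREEM.six_mul_le_of_lt_misfit hπ hM (hrank h) (by positivity) hd hlt
  refine DREEM.toOuterMeasure_not_isAccurate_testSet_le hF hτ ⟨_, hstar⟩ hPi hH ?_ hδ hδ1 hφ0.le
    hnφ π
  subst hφ hT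
  exact DREEM.three_mul_le_roundBound hd hφ0 hβ

theorem theorem1 :
    ∃ c : ℝ, 0 < c ∧ ∀ C : ℝ, c ≤ C → ∃ C' : ℝ, 0 < C' ∧
      ∀ (S : Type*) (A : Type*) [Fintype A] [Nonempty A] (E : DREEM.Env S A) (H : ℕ)
        (Ms : Finset (DREEM.Model S A)) (Pi : Finset (DREEM.Policy S A))
        (_ : E.Mstar ∈ Ms) (_ : ∀ M ∈ Ms, ∃ π ∈ Pi, DREEM.IsOptimal E H M π)
        (β : ℝ) (d : ℕ)
        (_ : (⨆ h : Fin H, DREEM.normRank (DREEM.misfitMatrix E Pi Ms h) β) = (d : ℕ∞))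
        (ε δ : ℝ) (_ : 0 < ε) (_ : ε ≤ 1) (_ : 0 < δ) (_ : δ ≤ 1)
        (φ T : ℝ) (_ : φ = DREEM.threshold H (Fintype.card A) d ε)
        (_ : T = DREEM.roundBound H (Fintype.card A) d ε β) (_ : 0 < T)
        (n : ℕ)
        (_ : c * ((H : ℝ) ^ 4 * (Fintype.card A : ℝ) ^ 4 * d *
          Real.log (T * Ms.card * Pi.card / δ) / ε ^ 2) ≤ n)
        (_ : (n : ℝ) ≤ C * ((H : ℝ) ^ 4 * (Fintype.card A : ℝ) ^ 4 * d *
          Real.log (T * Ms.card * Pi.card / δ) / ε ^ 2))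
        (τ : DREEM.Policy S A → PMF (DREEM.Trajectory S A H))
        (_ : DREEM.IsTrajectoryLaw E H τ)
        (F : DREEM.Policy S A → DREEM.Model S A → Fin H → S × A × S → ℝ)
        (_ : DREEM.IsTestFamily E H Pi Ms F)
        (P : DREEM.Planner S A H n) (_ : P.IsExact E Pi Ms),
        ENNReal.ofReal (1 - δ) ≤
          DREEM.haltProb E τ (DREEM.testSet Pi Ms F) P ε φ Ms fun b π =>
            (∀ π' : DREEM.Policy S A,
              DREEM.value E H E.Mstar π' - ε ≤ DREEM.value E H E.Mstar π) ∧
            (DREEM.numTrajectories b : ℝ) ≤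
              C' * ((H : ℝ) ^ 5 * (d : ℝ) ^ 2 * (Fintype.card A : ℝ) ^ 4 / ε ^ 2 *
                Real.log (T * Ms.card * Pi.card / δ) * Real.log (β / (2 * φ))) := by
  have hlog53 : 0 < Real.log (5 / 3) := Real.log_pos (by norm_num)
  refine ⟨18432, by norm_num, fun C hC => ⟨C / Real.log (5 / 3), div_pos (by linarith) hlog53, ?_⟩⟩
  intro S A _ _ E H Ms Pi hstar hopt β d hrank ε δ hε _ hδ hδ1 φ T hφ hT hTpos n hn hnC τ hτ F hF
    P hP
  obtain ⟨ρ, hρ, hρopt⟩ := hopt _ hstar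
  refine (theorem1_general E H Ms Pi hstar ⟨ρ, hρ⟩ β d (fun h => (le_iSup _ h).trans hrank.le)
    ε δ hε hδ hδ1 φ T hφ hT hTpos n hn τ hτ F hF P hP).trans (DREEM.haltProb_mono ?_)
  rintro b π ⟨hπ, hb⟩
  refine ⟨fun π' => (sub_le_sub_right (hρopt π') ε).trans (hπ ρ hρ), ?_⟩
  subst hφ hT
  calc (DREEM.numTrajectories b : ℝ) = n * b.length := by
        rw [DREEM.numTrajectories, Nat.cast_mul]
    _ ≤ n * DREEM.roundBound H (Fintype.card A) d ε β := by gcongr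
    _ ≤ _ := DREEM.mul_roundBound_le hTpos.le hnC
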